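/- Let $z\in\mathbb C$ with $\operatorname{Im} z>0$, and put $q^{s}:=e^{2\pi i z s}$ for $s\in\mathbb C$; so $q=e^{2\pi i z}$, $|q|<1$, and $q^{1/2}=e^{\pi i z}$ (the principal root when $|\operatorname{Re} z|<\tfrac12$). Let $K(x)=\frac{\pi}{2}\,{}_2F_1\!\left(\tfrac12,\tfrac12;1;x^2\right)$ for $|x|<1$. Let the modulus $k_r$ and the number $K$ be given in one of the following two ways. (a) $z=\tfrac{i\sqrt r}{2}$ with $r>0$, so that $q=e^{-\pi\sqrt r}$; $k_r\in(0,1)$ is the solution of $K\!\left(\sqrt{1-k_r^2}\right)/K(k_r)=\sqrt r$; and $K=K(k_r)$. (b) $z$ is arbitrary; $k_r=m(q):=\vartheta_2(q)^2/\vartheta_3(q)^2$ with $\vartheta_2(q)=\sum_{n\in\mathbb Z}q^{(n+1/2)^2}$ and $\vartheta_3(q)=\sum_{n\in\mathbb Z}q^{n^2}$; and $K=K(m(q))$, where $z\mapsto K(m(e^{2\pi i z}))$ is given by the formula above on the imaginary axis, where $0<m(q)<1$, and by analytic continuation to the upper half-plane. Let $\mathrm{sn}(q,u)$ and $\mathrm{dn}(q,u)$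 be the Jacobi elliptic functions of nome $q$ and real quarter period $K$, that is $$\mathrm{sn}(q,u)=\frac{\theta_3(0)}{\theta_2(0)}\frac{\theta_1(\zeta)}{\theta_4(\zeta)},\qquad \mathrm{dn}(q,u)=\frac{\theta_4(0)}{\theta_3(0)}\frac{\theta_3(\zeta)}{\theta_4(\zeta)},\qquad \zeta=\frac{\pi u}{2K},$$ with the theta functions $\theta_j(\cdot)=\theta_j(\cdot,q)$, and let $\mathrm{nd}=1/\mathrm{dn}$, $\mathrm{sd}=\mathrm{sn}/\mathrm{dn}$. For $|A|<1$ put $(a;q)_\infty=\prod_{n\ge0}(1-aq^n)$, $$P=\left(\frac{(-A;q)_\infty}{(A;q)_\infty}\right)^2,\qquad u_0(q,A)=\frac{P-1}{P+1}.$$ Let $\log\left(-1+\frac{2}{1-u_0(q,A)}\right)$ denote the holomorphic branch on $|A|<1$ that vanishes at $A=0$ (at the isolated points with $P=-1$, where $u_0$ has a pole, the expression $-1+\frac2{1-u_0}$ takes its limit value $-1$). Let $\log\left(\mathrm{nd}(q,u)+k_r\,\mathrm{sd}(q,u)\right)$ denote the holomorphic branch, on the strip $\left|\operatorname{Im}\frac{\pi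 u}{2K}\right|<\pi\operatorname{Im}z$ (which is $|\operatorname{Im}u|<K\!\left(\sqrt{1-k_r^2}\right)$ in case (a)), that vanishes at $u=0$. Both branches exist. For every $u$ in this strip and $A=iq^{1/2}e^{i\pi u/(2K)}$ we have $|A|<1$, the series below converges absolutely, and $$\log\left(-1+\frac{2}{1-u_0(q,A)}\right)=-\log\left(\mathrm{nd}(q,u)+k_r\,\mathrm{sd}(q,u)\right)+4i\sum_{n=0}^{\infty}\frac{(-1)^n q^{n+1/2}\cos\left((2n+1)\frac{\pi u}{2K}\right)}{(2n+1)\left(1-q^{2n+1}\right)}.$$ -/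

import Mathlib

open Complex

noncomputable section

/-- The power `q ^ s = exp (2 π i z s)` of the nome `q = e(z) = exp (2 π i z)`; in particular
`q ^ (1/2) = exp (π i z)`, which is the principal root when `|Re z| < 1/2`. -/
def qpow (z s : ℂ) : ℂ := cexp (2 * Real.pi * I * z * s)

/-- The nome `q = e(z) = exp (2 π i z)`, which has `‖q‖ < 1` when `0 < Im z`. -/
def nome (z : ℂ) : ℂ := qpow z 1

/-! ### Theta functions of nome `q = e(z)`

Mathlib's `jacobiTheta₂ w τ` is `∑ exp (2 π i n w + π i n ^ 2 τ)`, so `τ = 2 z` here. -/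

/-- `θ₁(ζ, q) = -i ∑ (-1)^n q^((n+1/2)^2) e^((2n+1) i ζ)`, `n ∈ ℤ`. -/
def theta1 (z ζ : ℂ) : ℂ :=
  -I * qpow z (1 / 4) * cexp (I * ζ) * jacobiTheta₂ (ζ / Real.pi + 1 / 2 + z) (2 * z)

/-- `θ₂(ζ, q) = ∑ q^((n+1/2)^2) e^((2n+1) i ζ)`, `n ∈ ℤ`. -/
def theta2 (z ζ : ℂ) : ℂ :=
  qpow z (1 / 4) * cexp (I * ζ) * jacobiTheta₂ (ζ / Real.pi + z) (2 * z)

/-- `θ₃(ζ, q) = ∑ q^(n^2) e^(2 n i ζ)`, `n ∈ ℤ`. -/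
def theta3 (z ζ : ℂ) : ℂ := jacobiTheta₂ (ζ / Real.pi) (2 * z)

/-- `θ₄(ζ, q) = ∑ (-1)^n q^(n^2) e^(2 n i ζ)`, `n ∈ ℤ`. -/
def theta4 (z ζ : ℂ) : ℂ := jacobiTheta₂ (ζ / Real.pi + 1 / 2) (2 * z)

theorem cexp_pi_mul_I_mul_int (n : ℤ) : cexp (Real.pi * I * n) = (-1) ^ n := by
  rw [mul_comm, Complex.exp_int_mul, Complex.exp_pi_mul_I]

theorem theta1_eq_tsum (z ζ : ℂ) : theta1 z ζ =
    -I * ∑' n : ℤ, (-1) ^ n * qpow z ((n + 1 / 2) ^ 2) * cexp ((2 * n + 1) * I * ζ) := by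
  have hpi : (Real.pi : ℂ) ≠ 0 := by exact_mod_cast Real.pi_ne_zero
  unfold theta1 jacobiTheta₂ qpow
  rw [mul_assoc, mul_assoc, ← mul_assoc (cexp _), ← tsum_mul_left]
  congr 2
  funext n
  rw [jacobiTheta₂_term, ← cexp_pi_mul_I_mul_int, ← Complex.exp_add, ← Complex.exp_add,
    ← Complex.exp_add, ← Complex.exp_add]
  congr 1
  field_simp
  ring

theorem theta2_eq_tsum (z ζ : ℂ) : theta2 z ζ =
    ∑' n : ℤ, qpow z ((n + 1 / 2) ^ 2) * cexp ((2 * n + 1) * I * ζ) := by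
  have hpi : (Real.pi : ℂ) ≠ 0 := by exact_mod_cast Real.pi_ne_zero
  unfold theta2 jacobiTheta₂ qpow
  rw [← tsum_mul_left]
  congr 1
  funext n
  rw [jacobiTheta₂_term, ← Complex.exp_add, ← Complex.exp_add, ← Complex.exp_add]
  congr 1
  field_simp
  ring

theorem theta3_eq_tsum (z ζ : ℂ) : theta3 z ζ =
    ∑' n : ℤ, qpow z (n ^ 2) * cexp (2 * n * I * ζ) := by
  have hpi : (Real.pi : ℂ) ≠ 0 := by exact_mod_cast Real.pi_ne_zero
  unfold theta3 jacobiTheta₂ qpow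
  congr 1
  funext n
  rw [jacobiTheta₂_term, ← Complex.exp_add]
  congr 1
  field_simp
  ring

theorem theta4_eq_tsum (z ζ : ℂ) : theta4 z ζ =
    ∑' n : ℤ, (-1) ^ n * qpow z (n ^ 2) * cexp (2 * n * I * ζ) := by
  have hpi : (Real.pi : ℂ) ≠ 0 := by exact_mod_cast Real.pi_ne_zero
  unfold theta4 jacobiTheta₂ qpow
  congr 1
  funext n
  rw [jacobiTheta₂_term, ← cexp_pi_mul_I_mul_int, ← Complex.exp_add, ← Complex.exp_add]
  congr 1
  field_simp
  ring

/-! ### Modulus and complete elliptic integral -/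

/-- The modulus `m(q) = ϑ₂(q)^2 / ϑ₃(q)^2`, with `ϑ₂(q) = ∑ q^((n+1/2)^2)` and
`ϑ₃(q) = ∑ q^(n^2)` over `n ∈ ℤ`. -/
def modulus (z : ℂ) : ℂ := theta2 z 0 ^ 2 / theta3 z 0 ^ 2

/-- The complete elliptic integral `K(x) = (π/2) ₂F₁(1/2, 1/2; 1; x^2)`, for `‖x‖ < 1`. -/
def ellipticK (x : ℂ) : ℂ :=
  Real.pi / 2 * ordinaryHypergeometric (1 / 2 : ℂ) (1 / 2 : ℂ) (1 : ℂ) (x ^ 2)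

/-- `k` is the singular modulus `k_r`: `0 < k < 1` and `K(√(1 - k^2)) / K(k) = √r`. -/
def IsSingularModulus (r k : ℝ) : Prop :=
  0 < k ∧ k < 1 ∧ ellipticK (Real.sqrt (1 - k ^ 2) : ℝ) / ellipticK k = (Real.sqrt r : ℝ)

/-- `κ` is the function `z ↦ K(m(q))`, `q = e(z)`, on the upper half-plane: it is given by
`ellipticK` on the imaginary axis, where `0 < m(q) < 1`, and by analytic continuation elsewhere. -/
def IsKContinuation (κ : ℂ → ℂ) : Prop :=
  DifferentiableOn ℂ κ {z | 0 < z.im} ∧ ∀ y : ℝ, 0 < y → κ (y * I) = ellipticK (modulus (y * I))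

/-! ### Jacobi elliptic functions of nome `q = e(z)` and real quarter period `K` -/

/-- The normalized argument `ζ = π u / (2 K)`. -/
def zetaArg (K u : ℂ) : ℂ := Real.pi * u / (2 * K)

def jacobiSn (z K u : ℂ) : ℂ :=
  theta3 z 0 / theta2 z 0 * (theta1 z (zetaArg K u) / theta4 z (zetaArg K u))

def jacobiDn (z K u : ℂ) : ℂ :=
  theta4 z 0 / theta3 z 0 * (theta3 z (zetaArg K u) / theta4 z (zetaArg K u))

/-- `nd = 1 / dn`. -/
def jacobiNd (z K u : ℂ) : ℂ := 1 / jacobiDn z K u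

/-- `sd = sn / dn`. -/
def jacobiSd (z K u : ℂ) : ℂ := jacobiSn z K u / jacobiDn z K u

/-! ### The function `u₀` -/

/-- `(a; q)_∞ = ∏ (1 - a q^n)`, `n ≥ 0`, for `‖q‖ < 1`. -/
def qPoch (a q : ℂ) : ℂ := ∏' n : ℕ, (1 - a * q ^ n)

/-- `P = ((-A; q)_∞ / (A; q)_∞)^2`. -/
def ratioP (q A : ℂ) : ℂ := (qPoch (-A) q / qPoch A q) ^ 2

/-- `u₀(q, A) = (P - 1) / (P + 1)`, defined when `P ≠ -1`. -/
def uZero (q A : ℂ) : ℂ := (ratioP q A - 1) / (ratioP q A + 1)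

/-! ### Logarithms -/

/-- `L` is the holomorphic branch on `U` of `log f` that vanishes at `w₀`. Points of `S`, where `f`
is not defined by its formula (isolated removable singularities), carry no condition of their own:
the value of `L` there is the limit of the values nearby. -/
def IsLogBranch (f : ℂ → ℂ) (U S : Set ℂ) (w₀ : ℂ) (L : ℂ → ℂ) : Prop :=
  DifferentiableOn ℂ L U ∧ L w₀ = 0 ∧ ∀ w ∈ U, w ∉ S → cexp (L w) = f w

/-- `L` is the branch of `A ↦ log (-1 + 2 / (1 - u₀(q, A)))` on `‖A‖ < 1` that vanishes at `A = 0`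
(and so is the real logarithm where `q` and `A` are real). -/
def IsLogUZero (q : ℂ) (L : ℂ → ℂ) : Prop :=
  IsLogBranch (fun A => -1 + 2 / (1 - uZero q A)) {A | ‖A‖ < 1} {A | ratioP q A = -1} 0 L

/-- The open strip `‖q^(1/2) e^(± i π u / (2 K))‖ < 1`, that is `|Im (π u / (2 K))| < π Im z`; this
is `|Im u| < K'` when `q` is real and positive. -/
def uStrip (z K : ℂ) : Set ℂ := {u | |(zetaArg K u).im| < Real.pi * z.im}

/-- `M` is the branch of `u ↦ log (nd(q, u) + k sd(q, u))` on the strip that vanishes at `u = 0`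
(and so is the real logarithm of a positive number where `q > 0` and `u` is real). -/
def IsLogNdSd (z k K : ℂ) (M : ℂ → ℂ) : Prop :=
  IsLogBranch (fun u => jacobiNd z K u + k * jacobiSd z K u) (uStrip z K) ∅ 0 M

end

noncomputable section

open Filter Topology

/-! ### The Jacobi triple product -/

/-! Put `ζ = π u / (2 K)`, `A = i q^(1/2) e^(iζ)` and `B = i q^(1/2) e^(-iζ)`; on the strip both lie
in the unit disc. All three terms of the identity are expressed through one odd power series,
`qAtanh q A`, a logarithm of `(-A; q)_∞ / (A; q)_∞` (`cexp_qAtanh`).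

Since `-1 + 2 / (1 - u₀) = P`, the left side is `2 qAtanh q A`. The doubling formula for products of
theta series (`jacobiTheta₂_mul`) writes `nd + k sd`, for `k = θ₂² / θ₃²`, as a quotient of two
theta values of nome `q^(1/2)`; the Jacobi triple product turns this into `exp (qAtanh q B - qAtanh
q A)`. Hence the left side plus `log (nd + k sd)` is `qAtanh q A + qAtanh q B`, and Euler's formula
for `A^(2n+1) + B^(2n+1)` makes this the cosine series. Normalization at the base points fixes the
branches (`eqOn_of_cexp_eventuallyEq`). The quarter period enters only through `ζ`.

For a singular modulus it must also be shown that `k_r = θ₂² / θ₃²` at nome `exp (-π √r)`. Landen's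
transformation and the duplication formulas for theta constants make `₂F₁(1/2, 1/2; 1; k²) / θ₃²`
invariant under squaring the nome, hence equal to its limit `1`. With the inversion `t ↦ 1/t` this
gives `K'/K = t` at nome `exp (-π t)`, and `K'/K` is strictly decreasing in the modulus, so the
solution is unique. -/

theorem summable_norm_qPoch {q : ℂ} (hq : ‖q‖ < 1) (a : ℂ) : Summable fun n : ℕ => ‖-(a * q ^ n)‖ := by
  simp only [norm_neg, norm_mul, norm_pow]
  exact (summable_geometric_of_lt_one (norm_nonneg _) hq).mul_left _

theorem multipliable_qPoch {q : ℂ} (hq : ‖q‖ < 1) (a : ℂ) :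
    Multipliable fun n : ℕ => 1 - a * q ^ n := by
  simpa [sub_eq_add_neg] using multipliable_one_add_of_summable (summable_norm_qPoch hq a)

theorem tendsto_qPoch {q : ℂ} (hq : ‖q‖ < 1) (a : ℂ) :
    Tendsto (fun N : ℕ => ∏ n ∈ Finset.range N, (1 - a * q ^ n)) atTop (𝓝 (qPoch a q)) :=
  (multipliable_qPoch hq a).hasProd.tendsto_prod_nat

theorem qPoch_ne_zero {q a : ℂ} (hq : ‖q‖ < 1) (ha : ∀ n : ℕ, a * q ^ n ≠ 1) : qPoch a q ≠ 0 := by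
  have := tprod_one_add_ne_zero_of_summable (f := fun n : ℕ => -(a * q ^ n))
    (fun n h => ha n (by linear_combination -h)) (summable_norm_qPoch hq a)
  simpa [qPoch, sub_eq_add_neg] using this

theorem mul_pow_ne_one {q a : ℂ} (hq : ‖q‖ < 1) (ha : ‖a‖ < 1) (n : ℕ) : a * q ^ n ≠ 1 := by
  intro h
  have h1 : ‖a * q ^ n‖ < 1 := by
    rw [norm_mul, norm_pow]
    calc ‖a‖ * ‖q‖ ^ n ≤ ‖a‖ * 1 := by
          gcongr; exact pow_le_one₀ (norm_nonneg _) hq.le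
      _ < 1 := by simpa
  rw [h] at h1
  simp at h1

theorem qPoch_ne_zero_of_norm_lt {q a : ℂ} (hq : ‖q‖ < 1) (ha : ‖a‖ < 1) : qPoch a q ≠ 0 :=
  qPoch_ne_zero hq (mul_pow_ne_one hq ha)

/-- The finite product `(q; q)_n`. -/
def qFact (q : ℂ) (n : ℕ) : ℂ := ∏ j ∈ Finset.range n, (1 - q * q ^ j)

/-- `1 / (q; q)_n`, extended by `0` to negative `n`. -/
def qFactInv (q : ℂ) (n : ℤ) : ℂ := if 0 ≤ n then (qFact q n.toNat)⁻¹ else 0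

theorem qFact_succ (q : ℂ) (n : ℕ) : qFact q (n + 1) = qFact q n * (1 - q ^ (n + 1)) := by
  rw [qFact, Finset.prod_range_succ, ← qFact, pow_succ' q n]

theorem qFact_ne_zero {q : ℂ} (hq : ‖q‖ < 1) (n : ℕ) : qFact q n ≠ 0 :=
  Finset.prod_ne_zero_iff.mpr fun j _ => sub_ne_zero.mpr (mul_pow_ne_one hq hq j).symm

/-- The extension by `0` makes the recurrence valid for every integer: at `n = 0` the factor `1 - q
^ 0` vanishes. This avoids boundary cases in the triple product. -/
theorem qFactInv_sub_one {q : ℂ} (hq : ‖q‖ < 1) (n : ℤ) :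
    qFactInv q (n - 1) = (1 - q ^ n) * qFactInv q n := by
  rcases lt_trichotomy n 0 with h | rfl | h
  · simp [qFactInv, show ¬ 0 ≤ n by omega, show ¬ 1 ≤ n by omega]
  · simp [qFactInv]
  · obtain ⟨m, rfl⟩ : ∃ m : ℕ, n = m + 1 := ⟨(n - 1).toNat, by omega⟩
    have h1 := qFact_ne_zero hq m
    have h2 := qFact_ne_zero hq (m + 1)
    have e : ((m : ℤ) + 1).toNat = m + 1 := by omega
    have e' : q ^ ((m : ℤ) + 1) = q ^ (m + 1) := by exact_mod_cast zpow_natCast q (m + 1)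
    simp only [qFactInv, add_sub_cancel_right, Int.natCast_nonneg, if_true, Int.toNat_natCast,
      show (0 : ℤ) ≤ m + 1 by omega, e, e']
    field_simp
    rw [qFact_succ]

theorem tendsto_qFact {q : ℂ} (hq : ‖q‖ < 1) : Tendsto (qFact q) atTop (𝓝 (qPoch q q)) :=
  tendsto_qPoch hq q

theorem tendsto_qFactInv {q : ℂ} (hq : ‖q‖ < 1) :
    Tendsto (qFactInv q) atTop (𝓝 (qPoch q q)⁻¹) := by
  have h := ((tendsto_qFact hq).inv₀ (qPoch_ne_zero_of_norm_lt hq hq)).comp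
    (tendsto_atTop_atTop.mpr fun b : ℕ => ⟨(b : ℤ), fun a h => by omega⟩ : Tendsto Int.toNat atTop atTop)
  refine h.congr' ?_
  filter_upwards [eventually_ge_atTop 0] with n hn
  simp [qFactInv, hn]

theorem exists_bound_qFactInv {q : ℂ} (hq : ‖q‖ < 1) : ∃ B : ℝ, ∀ n, ‖qFactInv q n‖ ≤ B := by
  obtain ⟨B, hB⟩ := (((tendsto_qFact hq).inv₀ (qPoch_ne_zero_of_norm_lt hq hq)).norm).bddAbove_range
  refine ⟨max B 0, fun n => ?_⟩
  unfold qFactInv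
  split_ifs
  · exact le_max_of_le_left (hB ⟨_, rfl⟩)
  · simp

theorem exists_bound_qFact {q : ℂ} (hq : ‖q‖ < 1) : ∃ B : ℝ, ∀ n, ‖qFact q n‖ ≤ B := by
  obtain ⟨B, hB⟩ := (tendsto_qFact hq).norm.bddAbove_range
  exact ⟨B, fun n => hB ⟨_, rfl⟩⟩

/-- The coefficient of `x ^ n` in `∏ (1 + x p ^ (2 j + 1)) (1 + x⁻¹ p ^ (2 j + 1))`, `j < N`. -/
def tripleCoeff (p : ℂ) (N : ℕ) (n : ℤ) : ℂ :=
  qFact (p ^ 2) (2 * N) * qFactInv (p ^ 2) (N - n) * qFactInv (p ^ 2) (N + n) * p ^ (n ^ 2)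

theorem norm_sq_lt_one {p : ℂ} (hp : ‖p‖ < 1) : ‖p ^ 2‖ < 1 := by
  rw [norm_pow]; exact pow_lt_one₀ (norm_nonneg _) hp two_ne_zero

/-- The new factor is `(1 + x p^(2N+1)) (1 + x⁻¹ p^(2N+1)) = (1 + p^(4N+2)) + p^(2N+1) (x + x⁻¹)`;
this compares coefficients of `x ^ n`. -/
theorem tripleCoeff_succ {p : ℂ} (hp : ‖p‖ < 1) (h0 : p ≠ 0) (N : ℕ) (n : ℤ) :
    tripleCoeff p (N + 1) n = (1 + p ^ (4 * N + 2)) * tripleCoeff p N n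
      + p ^ (2 * N + 1) * (tripleCoeff p N (n - 1) + tripleCoeff p N (n + 1)) := by
  have hq := norm_sq_lt_one hp
  have hq0 : p ^ 2 ≠ 0 := pow_ne_zero 2 h0
  -- These are the largest indices that occur, so every `qFactInv` is a multiple of the one at `a`
  -- or `b`, and what remains is a rational identity in `p²`, `X = p^(2a)` and `Y = p^(2b)`.
  set a : ℤ := N + 1 - n with ha
  set b : ℤ := N + 1 + n with hb
  have e1 : qFactInv (p ^ 2) (a - 1) = _ := qFactInv_sub_one hq a
  have e2 : qFactInv (p ^ 2) (b - 1) = _ := qFactInv_sub_one hq b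
  have e3 : qFactInv (p ^ 2) (a - 1 - 1) = _ := qFactInv_sub_one hq (a - 1)
  have e4 : qFactInv (p ^ 2) (b - 1 - 1) = _ := qFactInv_sub_one hq (b - 1)
  have e5 : (p ^ (2 : ℕ)) ^ (a - 1) = (p ^ 2) ^ a / p ^ 2 := by rw [zpow_sub_one₀ hq0]; rfl
  have e6 : (p ^ (2 : ℕ)) ^ (b - 1) = (p ^ 2) ^ b / p ^ 2 := by rw [zpow_sub_one₀ hq0]; rfl
  rw [e1, e5] at e3
  rw [e2, e6] at e4
  have hXY : (p ^ 2) ^ a * (p ^ 2) ^ b = p ^ (4 * N + 2) * p ^ 2 := by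
    rw [← zpow_add₀ hq0, ← pow_add, ← zpow_natCast p 2, ← zpow_mul, ← zpow_natCast]
    congr 1
    push_cast
    rw [ha, hb]; ring
  have hm : p ^ (2 * N + 1) * p ^ ((n - 1) ^ 2) = p ^ n ^ 2 * (p ^ 2) ^ a := by
    rw [← zpow_natCast p 2, ← zpow_mul, ← zpow_natCast, ← zpow_add₀ h0, ← zpow_add₀ h0]
    congr 1
    push_cast
    rw [ha]; ring
  have hpl : p ^ (2 * N + 1) * p ^ ((n + 1) ^ 2) = p ^ n ^ 2 * (p ^ 2) ^ b := by
    rw [← zpow_natCast p 2, ← zpow_mul, ← zpow_natCast, ← zpow_add₀ h0, ← zpow_add₀ h0]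
    congr 1
    push_cast
    rw [hb]; ring
  have hQ : qFact (p ^ 2) (2 * (N + 1)) = qFact (p ^ 2) (2 * N) *
      (1 - p ^ (4 * N + 2)) * (1 - p ^ (4 * N + 2) * p ^ 2) := by
    rw [show 2 * (N + 1) = 2 * N + 1 + 1 by ring, qFact_succ, qFact_succ, ← pow_mul, ← pow_mul,
      ← pow_add]
    ring_nf
  unfold tripleCoeff
  rw [hQ, show ((N + 1 : ℕ) : ℤ) - n = a by push_cast; rw [ha],
    show ((N + 1 : ℕ) : ℤ) + n = b by push_cast; rw [hb],
    show (N : ℤ) - n = a - 1 by rw [ha]; ring, show (N : ℤ) + n = b - 1 by rw [hb]; ring,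
    show (N : ℤ) - (n - 1) = a by rw [ha]; ring, show (N : ℤ) + (n - 1) = b - 1 - 1 by rw [hb]; ring,
    show (N : ℤ) - (n + 1) = a - 1 - 1 by rw [ha]; ring, show (N : ℤ) + (n + 1) = b by rw [hb]; ring,
    e1, e2, e3, e4]
  set X := (p ^ 2) ^ a
  set Y := (p ^ 2) ^ b
  have hW : p ^ (4 * N + 2) = X * Y / p ^ 2 := by rw [hXY]; field_simp
  rw [hW, mul_add]
  set Q := qFact (p ^ 2) (2 * N)
  set E := qFactInv (p ^ 2) a
  set F := qFactInv (p ^ 2) b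
  have r1 : p ^ (2 * N + 1) * (Q * E * ((1 - Y / p ^ 2) * ((1 - Y) * F)) * p ^ ((n - 1) ^ 2)) =
    Q * E * ((1 - Y / p ^ 2) * ((1 - Y) * F)) * (p ^ n ^ 2 * X) := by rw [← hm]; ring
  have r2 : p ^ (2 * N + 1) * (Q * ((1 - X / p ^ 2) * ((1 - X) * E)) * F * p ^ ((n + 1) ^ 2)) =
    Q * ((1 - X / p ^ 2) * ((1 - X) * E)) * F * (p ^ n ^ 2 * Y) := by rw [← hpl]; ring
  rw [r1, r2]
  field_simp
  ring

theorem tripleCoeff_eq_zero (p : ℂ) (N : ℕ) (n : ℤ) (h : (N : ℤ) < |n|) : tripleCoeff p N n = 0 := by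
  rcases abs_cases n with ⟨h1, -⟩ | ⟨h1, -⟩
  · simp [tripleCoeff, qFactInv, show ¬ n ≤ N by omega]
  · have : ¬ (0 : ℤ) ≤ N + n := by omega
    simp [tripleCoeff, qFactInv, this]

theorem summable_tripleCoeff (p : ℂ) (N : ℕ) (x : ℂ) :
    Summable fun n : ℤ => tripleCoeff p N n * x ^ n := by
  refine summable_of_hasFiniteSupport ((Set.finite_Icc (-(N : ℤ)) N).subset fun n hn => ?_)
  by_contra h
  rw [Set.mem_Icc, ← abs_le, not_le] at h
  exact hn (by simp [tripleCoeff_eq_zero p N n h])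

theorem finite_triple_product {p x : ℂ} (hp : ‖p‖ < 1) (h0 : p ≠ 0) (hx : x ≠ 0) (N : ℕ) :
    ∏ j ∈ Finset.range N, ((1 - -p * x * (p ^ 2) ^ j) * (1 - -p * x⁻¹ * (p ^ 2) ^ j)) =
      ∑' n : ℤ, tripleCoeff p N n * x ^ n := by
  induction N with
  | zero =>
    rw [tsum_eq_single 0]
    · simp [tripleCoeff, qFactInv, qFact]
    · intro n hn
      rw [tripleCoeff_eq_zero, zero_mul]
      simpa using hn
  | succ N ih =>
    rw [Finset.prod_range_succ, ih]
    have s := summable_tripleCoeff p N x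
    have s1 : Summable fun n : ℤ => tripleCoeff p N (n - 1) * x ^ (n - 1) :=
      (Equiv.subRight (1 : ℤ)).summable_iff (f := fun n => tripleCoeff p N n * x ^ n) |>.mpr s
    have s2 : Summable fun n : ℤ => tripleCoeff p N (n + 1) * x ^ (n + 1) :=
      (Equiv.addRight (1 : ℤ)).summable_iff (f := fun n => tripleCoeff p N n * x ^ n) |>.mpr s
    have t1 : ∑' n : ℤ, tripleCoeff p N (n - 1) * x ^ (n - 1) = _ :=
      (Equiv.subRight (1 : ℤ)).tsum_eq fun n => tripleCoeff p N n * x ^ n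
    have t2 : ∑' n : ℤ, tripleCoeff p N (n + 1) * x ^ (n + 1) = _ :=
      (Equiv.addRight (1 : ℤ)).tsum_eq fun n => tripleCoeff p N n * x ^ n
    have key : ∀ n : ℤ, tripleCoeff p (N + 1) n * x ^ n =
        (1 + p ^ (4 * N + 2)) * (tripleCoeff p N n * x ^ n) +
        (p ^ (2 * N + 1) * x * (tripleCoeff p N (n - 1) * x ^ (n - 1)) +
          p ^ (2 * N + 1) * x⁻¹ * (tripleCoeff p N (n + 1) * x ^ (n + 1))) := by
      intro n
      rw [tripleCoeff_succ hp h0, zpow_sub_one₀ hx, zpow_add_one₀ hx]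
      field_simp
    simp_rw [key]
    have d := (s.hasSum.mul_left (1 + p ^ (4 * N + 2))).add
      (((t1 ▸ s1.hasSum).mul_left (p ^ (2 * N + 1) * x)).add
        ((t2 ▸ s2.hasSum).mul_left (p ^ (2 * N + 1) * x⁻¹)))
    rw [d.tsum_eq]
    generalize ∑' n : ℤ, tripleCoeff p N n * x ^ n = S
    have e : (p ^ 2) ^ N * p = p ^ (2 * N + 1) := by ring
    have e' : ((p ^ 2) ^ N * p) ^ 2 = p ^ (4 * N + 2) := by ring
    rw [← e', ← e]
    field_simp
    ring

theorem jacobiTheta₂_term_eq (n : ℤ) (v τ : ℂ) :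
    jacobiTheta₂_term n v τ = cexp (Real.pi * I * τ) ^ (n ^ 2) * cexp (2 * Real.pi * I * v) ^ n := by
  rw [← Complex.exp_int_mul, ← Complex.exp_int_mul, ← Complex.exp_add, jacobiTheta₂_term]
  congr 1
  push_cast
  ring

theorem norm_cexp_pi_I_lt_one {τ : ℂ} (hτ : 0 < τ.im) : ‖cexp (Real.pi * I * τ)‖ < 1 := by
  rw [Complex.norm_exp]
  simpa using mul_pos Real.pi_pos hτ

/-- **Jacobi triple product**. -/
theorem jacobiTheta₂_eq_prod (v : ℂ) {τ p x : ℂ} (hτ : 0 < τ.im) (hp : p = cexp (Real.pi * I * τ))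
    (hx : x = cexp (2 * Real.pi * I * v)) :
    jacobiTheta₂ v τ =
      qPoch (p ^ 2) (p ^ 2) * (qPoch (-p * x) (p ^ 2) * qPoch (-p * x⁻¹) (p ^ 2)) := by
  have hp1 : ‖p‖ < 1 := hp ▸ norm_cexp_pi_I_lt_one hτ
  have hp0 : p ≠ 0 := hp ▸ Complex.exp_ne_zero _
  have hx0 : x ≠ 0 := hx ▸ Complex.exp_ne_zero _
  have hq := norm_sq_lt_one hp1
  have hQ := qPoch_ne_zero_of_norm_lt hq hq
  have lim1 := (tendsto_qPoch hq (-p * x)).mul (tendsto_qPoch hq (-p * x⁻¹))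
  simp_rw [← Finset.prod_mul_distrib, finite_triple_product hp1 hp0 hx0] at lim1
  obtain ⟨B, hB⟩ := exists_bound_qFact hq
  obtain ⟨C, hC⟩ := exists_bound_qFactInv hq
  have hB0 : 0 ≤ B := (norm_nonneg _).trans (hB 0)
  have hC0 : 0 ≤ C := (norm_nonneg _).trans (hC 0)
  have hs : Summable fun n : ℤ => p ^ (n ^ 2) * x ^ n := by
    simpa only [jacobiTheta₂_term_eq, ← hp, ← hx] using (summable_jacobiTheta₂_term_iff v τ).mpr hτ
  -- Dominated convergence: the `q`-factorials and their inverses are bounded uniformly in `N`, so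
  -- the theta series itself dominates, and each coefficient tends to `p^(n²) / (p²; p²)_∞`.
  have lim2 : Tendsto (fun N : ℕ => ∑' n : ℤ, tripleCoeff p N n * x ^ n) atTop
      (𝓝 (∑' n : ℤ, (qPoch (p ^ 2) (p ^ 2))⁻¹ * (p ^ (n ^ 2) * x ^ n))) := by
    refine tendsto_tsum_of_dominated_convergence (bound := fun n => B * C * C * ‖p ^ (n ^ 2) * x ^ n‖)
      (hs.norm.mul_left _) (fun n => ?_) (Eventually.of_forall fun N n => ?_)
    · have a1 : Tendsto (fun N : ℕ => (N : ℤ) - n) atTop atTop :=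
        tendsto_atTop_add_const_right _ (-n) tendsto_natCast_atTop_atTop
      have a2 : Tendsto (fun N : ℕ => (N : ℤ) + n) atTop atTop :=
        tendsto_atTop_add_const_right _ n tendsto_natCast_atTop_atTop
      have a3 : Tendsto (fun N : ℕ => 2 * N) atTop atTop :=
        tendsto_id.const_mul_atTop' (by norm_num)
      have := ((((tendsto_qFact hq).comp a3).mul ((tendsto_qFactInv hq).comp a1)).mul
        ((tendsto_qFactInv hq).comp a2)).mul_const (p ^ (n ^ 2) * x ^ n)
      rw [mul_inv_cancel₀ hQ, one_mul] at this
      refine this.congr fun N => ?_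
      simp only [Function.comp, tripleCoeff]
      ring
    · rw [tripleCoeff, mul_assoc, norm_mul, norm_mul, norm_mul]
      gcongr
      exacts [hB _, hC _, hC _]
  rw [tsum_mul_left] at lim2
  have := tendsto_nhds_unique lim1 lim2
  rw [this, mul_inv_cancel_left₀ hQ]
  simp only [jacobiTheta₂, jacobiTheta₂_term_eq, ← hp, ← hx]

/-- The bound on `Im v` says exactly that `p x` and `p x⁻¹` have norm below `1`, so no factor of the
triple product vanishes. -/
theorem jacobiTheta₂_ne_zero {v τ : ℂ} (hτ : 0 < τ.im) (hv : |2 * v.im| < τ.im) :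
    jacobiTheta₂ v τ ≠ 0 := by
  rw [jacobiTheta₂_eq_prod v hτ rfl rfl]
  have hq := norm_sq_lt_one (norm_cexp_pi_I_lt_one hτ)
  rw [abs_lt] at hv
  refine mul_ne_zero (qPoch_ne_zero_of_norm_lt hq hq) (mul_ne_zero
    (qPoch_ne_zero_of_norm_lt hq ?_) (qPoch_ne_zero_of_norm_lt hq ?_))
  · rw [neg_mul, norm_neg, ← Complex.exp_add, Complex.norm_exp]
    simp
    nlinarith [Real.pi_pos]
  · rw [neg_mul, norm_neg, ← Complex.exp_neg, ← Complex.exp_add, Complex.norm_exp]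
    simp
    nlinarith [Real.pi_pos]

/-! ### Products of theta functions -/

/-- Pairs of integers split by the parity of their sum; each class is parametrized by half-sums and
half-differences, with a shift by one in the odd class. -/
theorem hasSum_int_prod_parity {f : ℤ × ℤ → ℂ} {a b : ℂ}
    (h1 : HasSum (fun c : ℤ × ℤ => f (c.1 + c.2, c.1 - c.2)) a)
    (h2 : HasSum (fun c : ℤ × ℤ => f (c.1 + c.2 + 1, c.1 - c.2)) b) : HasSum f (a + b) := by
  let e1 : ℤ × ℤ → ℤ × ℤ := fun a => (a.1 + a.2, a.1 - a.2)
  let e2 : ℤ × ℤ → ℤ × ℤ := fun a => (a.1 + a.2 + 1, a.1 - a.2)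
  have i1 : Function.Injective e1 := fun a b hab => by
    simp only [e1, Prod.mk.injEq] at hab
    ext <;> omega
  have i2 : Function.Injective e2 := fun a b hab => by
    simp only [e2, Prod.mk.injEq] at hab
    ext <;> omega
  have hc : IsCompl (Set.range e1) (Set.range e2) := by
    rw [isCompl_iff, Set.disjoint_iff, codisjoint_iff]
    constructor
    · rintro _ ⟨⟨a, rfl⟩, ⟨b, hb⟩⟩
      simp only [e1, e2, Prod.mk.injEq] at hb
      simp only [Set.mem_empty_iff_false]
      omega
    · refine Set.eq_univ_of_forall fun a => ?_
      rcases Int.even_or_odd' (a.1 + a.2) with ⟨c, hc | hc⟩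
      · exact Or.inl ⟨(c, a.1 - c), by ext <;> simp only [e1] <;> omega⟩
      · exact Or.inr ⟨(c, a.1 - c - 1), by ext <;> simp only [e2] <;> omega⟩
  exact HasSum.add_isCompl (s := Set.range e1) (t := Set.range e2) hc
    (i1.hasSum_range_iff.mpr h1) (i2.hasSum_range_iff.mpr h2)

theorem HasSum.mul_of_complex {f g : ℤ → ℂ} {a b : ℂ} (hf : HasSum f a) (hg : HasSum g b) :
    HasSum (fun c : ℤ × ℤ => f c.1 * g c.2) (a * b) := by
  have h : Summable fun c : ℤ × ℤ => f c.1 * g c.2 :=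
    summable_mul_of_summable_norm hf.summable.norm hg.summable.norm
  exact HasSum.mul hf hg h

theorem hasSum_jacobiTheta₂_term_mul (v w : ℂ) {τ : ℂ} (hτ : 0 < τ.im) :
    HasSum (fun a : ℤ × ℤ => jacobiTheta₂_term a.1 v τ * jacobiTheta₂_term a.2 w τ)
      (jacobiTheta₂ v τ * jacobiTheta₂ w τ) :=
  HasSum.mul_of_complex (f := fun n => jacobiTheta₂_term n v τ)
    (g := fun n => jacobiTheta₂_term n w τ) (hasSum_jacobiTheta₂_term v hτ)
    (hasSum_jacobiTheta₂_term w hτ)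

/-- The change of indices `(r + s, r - s)` sends `m² + n²` to `2 (r² + s²)`, so the double series
factors again with `τ` doubled. The odd class gives the second product. -/
theorem jacobiTheta₂_mul (v w : ℂ) {τ : ℂ} (hτ : 0 < τ.im) :
    jacobiTheta₂ v τ * jacobiTheta₂ w τ =
      jacobiTheta₂ (v + w) (2 * τ) * jacobiTheta₂ (v - w) (2 * τ) +
      cexp (2 * Real.pi * I * v + Real.pi * I * τ) *
        (jacobiTheta₂ (v + w + τ) (2 * τ) * jacobiTheta₂ (v - w + τ) (2 * τ)) := by
  have hτ2 : 0 < (2 * τ).im := by simpa using hτ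
  have h1 := hasSum_jacobiTheta₂_term_mul (v + w) (v - w) hτ2
  have h2 := (hasSum_jacobiTheta₂_term_mul (v + w + τ) (v - w + τ) hτ2).mul_left
    (cexp (2 * Real.pi * I * v + Real.pi * I * τ))
  refine (hasSum_jacobiTheta₂_term_mul v w hτ).unique (hasSum_int_prod_parity ?_ ?_)
  · convert! h1 using 2 with a
    simp only [jacobiTheta₂_term, ← Complex.exp_add]
    congr 1
    push_cast
    ring
  · convert! h2 using 2 with a
    simp only [jacobiTheta₂_term, ← Complex.exp_add]
    congr 1
    push_cast
    ring

/-- Evenness and the two periods identify the values at `1/2 - z` and `1/2 + z`, while the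
quasi-period `2z` relates them by the factor `-1`. This is `θ₁(0) = 0`. -/
theorem jacobiTheta₂_half_add_eq_zero (z : ℂ) : jacobiTheta₂ (1 / 2 + z) (2 * z) = 0 := by
  have h1 := jacobiTheta₂_add_left' (1 / 2 - z) (2 * z)
  have h2 : jacobiTheta₂ (1 / 2 - z) (2 * z) = jacobiTheta₂ (1 / 2 + z) (2 * z) := by
    rw [← jacobiTheta₂_neg_left, ← jacobiTheta₂_add_left]
    congr 1
    ring
  have h3 : cexp (-Real.pi * I * (2 * z + 2 * (1 / 2 - z))) = -1 := by
    rw [show -Real.pi * I * (2 * z + 2 * (1 / 2 - z)) = -(Real.pi * I) by ring, Complex.exp_neg,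
      Complex.exp_pi_mul_I]
    norm_num
  rw [h2, h3, show 1 / 2 - z + 2 * z = 1 / 2 + z by ring] at h1
  linear_combination h1 / 2

/-- The arguments are chosen to differ by `1/2`, which kills the odd half of the product formula. -/
theorem theta3_mul_theta4_zero {z : ℂ} (hz : 0 < z.im) (ζ : ℂ) :
    theta3 z ζ * theta4 z 0 = jacobiTheta₂ (ζ / (2 * Real.pi) + 1 / 4) z *
      jacobiTheta₂ (ζ / (2 * Real.pi) - 1 / 4) z := by
  rw [jacobiTheta₂_mul _ _ hz, theta3, theta4]
  have e1 : ζ / (2 * Real.pi) + 1 / 4 + (ζ / (2 * Real.pi) - 1 / 4) = ζ / Real.pi := by ring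
  have e2 : ζ / (2 * Real.pi) + 1 / 4 - (ζ / (2 * Real.pi) - 1 / 4) = 1 / 2 := by ring
  rw [e1, e2, jacobiTheta₂_half_add_eq_zero]
  simp

/-- Equal arguments have difference `0`, which produces the constants `θ₃(0)` and `θ₂(0)`; the shift
by `1/4` becomes `1/2` in the sum and yields `θ₄` and `θ₁`. -/
theorem theta_add_eq_sq {z : ℂ} (hz : 0 < z.im) (ζ : ℂ) :
    theta3 z 0 * theta4 z ζ + theta2 z 0 * theta1 z ζ =
      jacobiTheta₂ (ζ / (2 * Real.pi) - 1 / 4) z ^ 2 := by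
  have hpi : (Real.pi : ℂ) ≠ 0 := by exact_mod_cast Real.pi_ne_zero
  rw [sq, jacobiTheta₂_mul _ _ hz, theta3, theta4, theta2, theta1]
  have e1 : ζ / (2 * Real.pi) - 1 / 4 + (ζ / (2 * Real.pi) - 1 / 4) = ζ / Real.pi - 1 / 2 := by ring
  have e2 : cexp (2 * Real.pi * I * (ζ / (2 * Real.pi) - 1 / 4) + Real.pi * I * z) =
      -I * cexp (I * ζ) * (qpow z (1 / 4) * qpow z (1 / 4)) := by
    rw [← Complex.exp_neg_pi_div_two_mul_I, qpow, ← Complex.exp_add, ← Complex.exp_add,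
      ← Complex.exp_add]
    congr 1
    field_simp
    ring
  have e3 : jacobiTheta₂ (ζ / Real.pi + 1 / 2) (2 * z) =
      jacobiTheta₂ (ζ / Real.pi - 1 / 2) (2 * z) := by
    rw [← jacobiTheta₂_add_left (ζ / Real.pi - 1 / 2)]
    congr 1
    ring
  have e4 : jacobiTheta₂ (ζ / Real.pi + 1 / 2 + z) (2 * z) =
      jacobiTheta₂ (ζ / Real.pi - 1 / 2 + z) (2 * z) := by
    rw [← jacobiTheta₂_add_left (ζ / Real.pi - 1 / 2 + z)]
    congr 1
    ring
  rw [e1, e2, e3, e4]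
  simp
  ring

theorem im_div_pi (ζ : ℂ) : (ζ / Real.pi).im = ζ.im / Real.pi := by
  rw [Complex.div_ofReal_im]

theorem theta3_ne_zero {z ζ : ℂ} (hz : 0 < z.im) (hζ : |ζ.im| < Real.pi * z.im) :
    theta3 z ζ ≠ 0 := by
  refine jacobiTheta₂_ne_zero (by simpa using hz) ?_
  have hpi := Real.pi_pos
  rw [im_div_pi, abs_mul, abs_div, abs_of_pos hpi]
  simp
  rw [div_lt_iff₀ hpi]
  linarith

theorem theta4_ne_zero {z ζ : ℂ} (hz : 0 < z.im) (hζ : |ζ.im| < Real.pi * z.im) :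
    theta4 z ζ ≠ 0 := by
  refine jacobiTheta₂_ne_zero (by simpa using hz) ?_
  have hpi := Real.pi_pos
  rw [Complex.add_im, im_div_pi, abs_mul, show ((1 / 2 : ℂ)).im = 0 by simp, add_zero, abs_div,
    abs_of_pos hpi]
  simp
  rw [div_lt_iff₀ hpi]
  linarith

/-- `nd + k sd` as a quotient of theta functions of nome `q ^ (1 / 2)`. -/
theorem jacobiNd_add_mul_jacobiSd {z K u : ℂ} (hz : 0 < z.im) (hu : u ∈ uStrip z K) :
    jacobiNd z K u + modulus z * jacobiSd z K u =
      jacobiTheta₂ (zetaArg K u / (2 * Real.pi) - 1 / 4) z /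
        jacobiTheta₂ (zetaArg K u / (2 * Real.pi) + 1 / 4) z := by
  have h0 : |(0 : ℂ).im| < Real.pi * z.im := by simpa using mul_pos Real.pi_pos hz
  unfold jacobiNd jacobiSd jacobiDn jacobiSn modulus
  have a1 := theta3_mul_theta4_zero hz (zetaArg K u)
  have a2 := theta_add_eq_sq hz (zetaArg K u)
  have n3 := theta3_ne_zero hz hu
  have n4 := theta4_ne_zero hz hu
  have n30 := theta3_ne_zero hz h0
  have n40 := theta4_ne_zero hz h0
  have hne := mul_ne_zero n3 n40
  rw [a1] at hne
  have hv := right_ne_zero_of_mul hne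
  have hv' := left_ne_zero_of_mul hne
  set J := jacobiTheta₂ (zetaArg K u / (2 * Real.pi) - 1 / 4) z
  set J' := jacobiTheta₂ (zetaArg K u / (2 * Real.pi) + 1 / 4) z
  have key : (theta3 z 0 * theta4 z (zetaArg K u) + theta2 z 0 * theta1 z (zetaArg K u)) /
      (theta3 z (zetaArg K u) * theta4 z 0) = J / J' := by
    rw [a1, a2]
    field_simp
  rw [← key]
  -- If `θ₂(0) = 0`, the quotient defining `sn` takes a default value, but then `k = 0` and both
  -- sides lose that term.
  rcases eq_or_ne (theta2 z 0) 0 with h2 | h2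
  · rw [h2]
    field_simp
  · field_simp

/-! ### The logarithm of the quotient of `q`-products -/

/-- `2 ∑ A ^ (2 j + 1) / ((2 j + 1) (1 - q ^ (2 j + 1)))`, the logarithm of
`(-A; q)_∞ / (A; q)_∞`. -/
def qAtanh (q A : ℂ) : ℂ := 2 * ∑' j : ℕ, A ^ (2 * j + 1) / ((2 * j + 1) * (1 - q ^ (2 * j + 1)))

theorem one_sub_norm_le {q : ℂ} (hq : ‖q‖ < 1) (j : ℕ) : 1 - ‖q‖ ≤ ‖1 - q ^ (2 * j + 1)‖ := by
  have h1 : ‖q ^ (2 * j + 1)‖ ≤ ‖q‖ := by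
    rw [norm_pow]
    exact pow_le_of_le_one (norm_nonneg _) hq.le (by omega)
  have h2 := norm_sub_norm_le 1 (q ^ (2 * j + 1))
  rw [norm_one] at h2
  linarith

/-- A bound uniform on `‖A‖ ≤ r`, giving both convergence and, by the M-test, holomorphy. -/
theorem norm_qAtanh_term_le {q A : ℂ} {r : ℝ} (hq : ‖q‖ < 1) (hr : r < 1) (hA : ‖A‖ ≤ r) (j : ℕ) :
    ‖A ^ (2 * j + 1) / ((2 * j + 1) * (1 - q ^ (2 * j + 1)))‖ ≤ r ^ j / (1 - ‖q‖) := by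
  have h1 := one_sub_norm_le hq j
  have h0 : 0 < 1 - ‖q‖ := by linarith
  have hA0 := norm_nonneg A
  have hr0 : 0 ≤ r := hA0.trans hA
  rw [norm_div, norm_mul, norm_pow]
  have h2 : (1 : ℝ) ≤ ‖(2 * j + 1 : ℂ)‖ := by
    have : (2 * j + 1 : ℂ) = ((2 * j + 1 : ℝ) : ℂ) := by push_cast; ring
    rw [this, Complex.norm_real, Real.norm_of_nonneg (by positivity)]
    have : (0 : ℝ) ≤ j := Nat.cast_nonneg j
    linarith
  have h3 : ‖A‖ ^ (2 * j + 1) ≤ r ^ j :=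
    (pow_le_pow_left₀ hA0 hA _).trans (pow_le_pow_of_le_one hr0 hr.le (by omega))
  have h4 : 1 - ‖q‖ ≤ ‖(2 * j + 1 : ℂ)‖ * ‖1 - q ^ (2 * j + 1)‖ := by nlinarith
  gcongr

theorem summable_qAtanh {q A : ℂ} (hq : ‖q‖ < 1) (hA : ‖A‖ < 1) :
    Summable fun j : ℕ => A ^ (2 * j + 1) / ((2 * j + 1) * (1 - q ^ (2 * j + 1))) :=
  Summable.of_norm_bounded ((summable_geometric_of_lt_one (norm_nonneg _) hA).div_const _)
    (norm_qAtanh_term_le hq hA le_rfl)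

theorem differentiableOn_qAtanh {q : ℂ} (hq : ‖q‖ < 1) :
    DifferentiableOn ℂ (qAtanh q) {A | ‖A‖ < 1} := by
  intro A (hA : ‖A‖ < 1)
  obtain ⟨r, h1, h2⟩ := exists_between hA
  have hd : DifferentiableOn ℂ (fun A : ℂ => ∑' j : ℕ,
      A ^ (2 * j + 1) / ((2 * j + 1) * (1 - q ^ (2 * j + 1)))) (Metric.ball 0 r) := by
    refine differentiableOn_tsum_of_summable_norm (u := fun j => r ^ j / (1 - ‖q‖))
      ((summable_geometric_of_lt_one ((norm_nonneg A).trans h1.le) h2).div_const _)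
      (fun j => ?_) Metric.isOpen_ball (fun j w hw => ?_)
    · exact (differentiable_id.pow _).differentiableOn.div_const _
    · exact norm_qAtanh_term_le hq h2 (mem_ball_zero_iff.mp hw).le j
  have := (hd.differentiableAt (Metric.isOpen_ball.mem_nhds (by simpa using h1))).const_mul 2
  exact this.differentiableWithinAt

/-- The even terms of the two Taylor series cancel and the odd ones double. -/
theorem hasSum_log_one_add_sub_log {w : ℂ} (hw : ‖w‖ < 1) :
    HasSum (fun j : ℕ => 2 * (w ^ (2 * j + 1) / (2 * j + 1))) (log (1 + w) - log (1 - w)) := by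
  have h := (hasSum_taylorSeries_log hw).add (hasSum_taylorSeries_neg_log hw)
  have hodd : Function.Injective fun j : ℕ => 2 * j + 1 := fun a b h => by
    simp only at h; omega
  rw [← hodd.hasSum_iff] at h
  · convert! h using 1
    ext j
    simp only [Function.comp]
    rw [show 2 * j + 1 + 1 = 2 * (j + 1) by ring, pow_mul]
    push_cast
    ring
  · intro n hn
    have : Even n := by
      by_contra h
      obtain ⟨j, hj⟩ := Nat.not_even_iff_odd.mp h
      exact hn ⟨j, hj.symm⟩
    rw [Odd.neg_one_pow this.add_one]
    ring

theorem one_le_norm_odd (j : ℕ) : (1 : ℝ) ≤ ‖(2 * j + 1 : ℂ)‖ := by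
  have : (2 * j + 1 : ℂ) = ((2 * j + 1 : ℝ) : ℂ) := by push_cast; ring
  rw [this, Complex.norm_real, Real.norm_of_nonneg (by positivity)]
  have : (0 : ℝ) ≤ j := Nat.cast_nonneg j
  linarith

theorem norm_mul_pow_lt_one {q A : ℂ} (hq : ‖q‖ < 1) (hA : ‖A‖ < 1) (n : ℕ) : ‖A * q ^ n‖ < 1 := by
  rw [norm_mul, norm_pow]
  calc ‖A‖ * ‖q‖ ^ n ≤ ‖A‖ * 1 := by
        gcongr; exact pow_le_one₀ (norm_nonneg _) hq.le
    _ < 1 := by simpa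

theorem summable_log_double {q A : ℂ} (hq : ‖q‖ < 1) (hA : ‖A‖ < 1) :
    Summable fun c : ℕ × ℕ => 2 * ((A * q ^ c.1) ^ (2 * c.2 + 1) / (2 * c.2 + 1)) := by
  refine Summable.of_norm_bounded (g := fun c : ℕ × ℕ => 2 * (‖q‖ ^ c.1 * ‖A‖ ^ c.2)) ?_ ?_
  · exact ((summable_geometric_of_lt_one (norm_nonneg _) hq).mul_of_nonneg
      (summable_geometric_of_lt_one (norm_nonneg _) hA) (fun _ => by positivity)
      (fun _ => by positivity)).mul_left 2
  · rintro ⟨n, j⟩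
    have h2 := one_le_norm_odd j
    have h3 : ‖(A * q ^ n) ^ (2 * j + 1)‖ ≤ ‖q‖ ^ n * ‖A‖ ^ j := by
      rw [norm_pow, norm_mul, norm_pow, mul_pow, mul_comm, ← pow_mul]
      exact mul_le_mul (pow_le_pow_of_le_one (norm_nonneg _) hq.le (by nlinarith))
        (pow_le_pow_of_le_one (norm_nonneg _) hA.le (by omega)) (by positivity) (by positivity)
    rw [norm_mul, norm_div, Complex.norm_ofNat]
    exact mul_le_mul_of_nonneg_left ((div_le_self (norm_nonneg _) h2).trans h3) (by norm_num)

theorem hasSum_geometric_odd {q : ℂ} (hq : ‖q‖ < 1) (A : ℂ) (j : ℕ) :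
    HasSum (fun n : ℕ => 2 * ((A * q ^ n) ^ (2 * j + 1) / (2 * j + 1)))
      (2 * (A ^ (2 * j + 1) / ((2 * j + 1) * (1 - q ^ (2 * j + 1))))) := by
  have hqj : ‖q ^ (2 * j + 1)‖ < 1 := by
    rw [norm_pow]; exact pow_lt_one₀ (norm_nonneg _) hq (by omega)
  have := (hasSum_geometric_of_norm_lt_one hqj).mul_left (2 * (A ^ (2 * j + 1) / (2 * j + 1)))
  rw [← div_eq_mul_inv, mul_div_assoc, div_div] at this
  convert! this using 1
  ext n
  rw [mul_pow, ← pow_mul, ← pow_mul, mul_comm n]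
  ring

/-- Expand each logarithm and exchange the two sums: for fixed odd exponent, the sum over `n` is
geometric with ratio `q^(2j+1)`. -/
theorem hasSum_log_qPoch {q A : ℂ} (hq : ‖q‖ < 1) (hA : ‖A‖ < 1) :
    HasSum (fun n : ℕ => log (1 + A * q ^ n) - log (1 - A * q ^ n)) (qAtanh q A) := by
  let f : ℕ × ℕ → ℂ := fun c => 2 * ((A * q ^ c.1) ^ (2 * c.2 + 1) / (2 * c.2 + 1))
  obtain ⟨S, hS⟩ : Summable f := summable_log_double hq hA
  have h1 := HasSum.prod_fiberwise hS
    fun n => (hasSum_log_one_add_sub_log (norm_mul_pow_lt_one hq hA n) :)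
  have h2 := HasSum.prod_fiberwise ((Equiv.prodComm ℕ ℕ).hasSum_iff.mpr hS)
    fun j => (hasSum_geometric_odd hq A j :)
  rwa [qAtanh, ← tsum_mul_left, h2.tsum_eq]

/-- Exponentials of partial sums are partial products, so no additivity of principal logarithms is
needed. -/
theorem cexp_qAtanh {q A : ℂ} (hq : ‖q‖ < 1) (hA : ‖A‖ < 1) :
    cexp (qAtanh q A) = qPoch (-A) q / qPoch A q := by
  have lim1 := (Complex.continuous_exp.tendsto _).comp (hasSum_log_qPoch hq hA).tendsto_sum_nat
  have lim2 := (tendsto_qPoch hq (-A)).div (tendsto_qPoch hq A) (qPoch_ne_zero_of_norm_lt hq hA)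
  refine tendsto_nhds_unique lim1 (lim2.congr fun N => ?_)
  simp only [Function.comp, Pi.div_apply]
  rw [← Finset.prod_div_distrib, Complex.exp_sum]
  refine Finset.prod_congr rfl fun n _ => ?_
  have n1 : 1 + A * q ^ n ≠ 0 := fun h => by
    have := norm_mul_pow_lt_one hq hA n
    rw [show A * q ^ n = -1 by linear_combination h] at this
    simp at this
  have n2 : 1 - A * q ^ n ≠ 0 := sub_ne_zero.mpr (mul_pow_ne_one hq hA n).symm
  rw [Complex.exp_sub, Complex.exp_log n1, Complex.exp_log n2]
  ring

/-- Near `w₀` the difference lies in `2πiℤ` and is small, hence zero; the identity theorem does the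
rest. Asking for equal exponentials only near `w₀` allows exceptional points elsewhere. -/
theorem eqOn_of_cexp_eventuallyEq {U : Set ℂ} {f g : ℂ → ℂ} {w₀ : ℂ} (hU : IsOpen U)
    (hc : IsPreconnected U) (hw : w₀ ∈ U) (hf : DifferentiableOn ℂ f U)
    (hg : DifferentiableOn ℂ g U) (h0 : f w₀ = g w₀)
    (h : ∀ᶠ w in 𝓝 w₀, cexp (f w) = cexp (g w)) : Set.EqOn f g U := by
  refine (hf.analyticOnNhd hU).eqOn_of_preconnected_of_eventuallyEq (hg.analyticOnNhd hU) hc hw ?_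
  have hcont : ContinuousAt (fun w => f w - g w) w₀ :=
    ((hf.sub hg).differentiableAt (hU.mem_nhds hw)).continuousAt
  have hsmall : ∀ᶠ w in 𝓝 w₀, ‖f w - g w‖ < 1 := by
    refine hcont.norm.eventually_lt continuousAt_const ?_
    simp [h0]
  filter_upwards [h, hsmall] with w h1 h2
  obtain ⟨n, hn⟩ := Complex.exp_eq_exp_iff_exists_int.mp h1
  have h3 : f w - g w = n * (2 * Real.pi * I) := by rw [hn]; ring
  have h4 : n = 0 := by
    by_contra h5
    have h6 : (1 : ℝ) ≤ |(n : ℝ)| := by exact_mod_cast Int.one_le_abs h5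
    rw [h3] at h2
    simp [abs_of_pos Real.pi_pos] at h2
    nlinarith [Real.pi_gt_three]
  rw [hn, h4]
  simp

/-! ### The identity for the theta modulus -/

theorem norm_qpow_lt_one {z : ℂ} (hz : 0 < z.im) {s : ℝ} (hs : 0 < s) : ‖qpow z s‖ < 1 := by
  rw [qpow, Complex.norm_exp]
  simpa using by positivity

theorem norm_nome_lt_one {z : ℂ} (hz : 0 < z.im) : ‖nome z‖ < 1 := by
  simpa [nome] using norm_qpow_lt_one hz one_pos

theorem qpow_half (z : ℂ) : qpow z (1 / 2) = cexp (Real.pi * I * z) := by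
  rw [qpow]; congr 1; ring

theorem qpow_half_sq (z : ℂ) : qpow z (1 / 2) ^ 2 = nome z := by
  rw [nome, qpow, qpow, ← Complex.exp_nat_mul]; congr 1; push_cast; ring

/-- The point `i q^(1/2) e^(iζ)`. -/
def rotNome (z ζ : ℂ) : ℂ := I * qpow z (1 / 2) * cexp (I * ζ)

theorem norm_rotNome_lt_one {z ζ : ℂ} (hζ : |ζ.im| < Real.pi * z.im) : ‖rotNome z ζ‖ < 1 := by
  rw [abs_lt] at hζ
  rw [rotNome, qpow_half, mul_assoc, norm_mul, Complex.norm_I, one_mul, ← Complex.exp_add,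
    Complex.norm_exp]
  simp
  linarith

/-- The triple product at `x = ∓i e^(iζ)`, where `(q; q)_∞` cancels and the factors `-p x^(±1)`
become `±A` and `±B`. -/
theorem theta_quotient_eq {z ζ : ℂ} (hz : 0 < z.im) :
    jacobiTheta₂ (ζ / (2 * Real.pi) - 1 / 4) z / jacobiTheta₂ (ζ / (2 * Real.pi) + 1 / 4) z =
      (qPoch (rotNome z ζ) (nome z) * qPoch (-rotNome z (-ζ)) (nome z)) /
        (qPoch (-rotNome z ζ) (nome z) * qPoch (rotNome z (-ζ)) (nome z)) := by
  have hpi : (Real.pi : ℂ) ≠ 0 := by exact_mod_cast Real.pi_ne_zero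
  have e1 : cexp (2 * Real.pi * I * (ζ / (2 * Real.pi) - 1 / 4)) = -I * cexp (I * ζ) := by
    rw [← Complex.exp_neg_pi_div_two_mul_I, ← Complex.exp_add]
    congr 1
    field_simp
    ring
  have e2 : cexp (2 * Real.pi * I * (ζ / (2 * Real.pi) + 1 / 4)) = I * cexp (I * ζ) := by
    have h := Complex.exp_pi_div_two_mul_I
    rw [← h, ← Complex.exp_add, h]
    congr 1
    field_simp
    ring
  have hI : (-I)⁻¹ = I := by rw [inv_neg, Complex.inv_I, neg_neg]
  rw [jacobiTheta₂_eq_prod _ hz (qpow_half z) e1.symm, jacobiTheta₂_eq_prod _ hz (qpow_half z) e2.symm,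
    qpow_half_sq, mul_div_mul_left _ _ (qPoch_ne_zero_of_norm_lt (norm_nome_lt_one hz)
      (norm_nome_lt_one hz)), mul_inv, mul_inv, ← Complex.exp_neg, hI, Complex.inv_I]
  have c1 : -qpow z (1 / 2) * (-I * cexp (I * ζ)) = rotNome z ζ := by rw [rotNome]; ring
  have c2 : -qpow z (1 / 2) * (I * cexp (-(I * ζ))) = -rotNome z (-ζ) := by
    rw [rotNome, mul_neg]; ring
  have c3 : -qpow z (1 / 2) * (I * cexp (I * ζ)) = -rotNome z ζ := by rw [rotNome]; ring
  have c4 : -qpow z (1 / 2) * (-I * cexp (-(I * ζ))) = rotNome z (-ζ) := by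
    rw [rotNome, mul_neg]; ring
  rw [c1, c2, c3, c4]

theorem rotNome_pow (z ζ : ℂ) (n : ℕ) : rotNome z ζ ^ (2 * n + 1) =
    I * ((-1) ^ n * qpow z (n + 1 / 2)) * cexp (I * ((2 * n + 1) * ζ)) := by
  have h1 : qpow z (1 / 2) ^ (2 * n + 1) = qpow z (n + 1 / 2) := by
    rw [qpow, qpow, ← Complex.exp_nat_mul]; congr 1; push_cast; ring
  have h2 : cexp (I * ζ) ^ (2 * n + 1) = cexp (I * ((2 * n + 1) * ζ)) := by
    rw [← Complex.exp_nat_mul]; congr 1; push_cast; ring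
  have h3 : I ^ (2 * n + 1) = (-1) ^ n * I := by rw [pow_succ, pow_mul, I_sq]
  rw [rotNome, mul_pow, mul_pow, h1, h2, h3]
  ring

/-- By Euler's formula `A^(2n+1) + B^(2n+1) = 2i (-1)^n q^(n+1/2) cos ((2n+1) ζ)`. -/
theorem hasSum_qAtanh_add {z ζ : ℂ} (hz : 0 < z.im) (hζ : |ζ.im| < Real.pi * z.im) :
    HasSum (fun n : ℕ => (-1) ^ n * qpow z (n + 1 / 2) * Complex.cos ((2 * n + 1) * ζ) /
      ((2 * n + 1) * (1 - nome z ^ (2 * n + 1))))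
      ((qAtanh (nome z) (rotNome z ζ) + qAtanh (nome z) (rotNome z (-ζ))) / (4 * I)) := by
  have hq := norm_nome_lt_one hz
  have h1 := (summable_qAtanh hq (norm_rotNome_lt_one hζ)).hasSum
  have h2 := (summable_qAtanh hq (norm_rotNome_lt_one (ζ := -ζ) (by simpa using hζ))).hasSum
  have h := (h1.add h2).div_const (2 * I)
  convert! h using 1
  · ext n
    rw [rotNome_pow, rotNome_pow, Complex.cos]
    have e1 : (2 * n + 1) * ζ * I = I * ((2 * n + 1) * ζ) := by ring
    have e2 : -((2 * n + 1) * ζ) * I = I * ((2 * n + 1) * -ζ) := by ring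
    rw [e1, e2]
    have := Complex.I_ne_zero
    field_simp
  · unfold qAtanh
    have := Complex.I_ne_zero
    field_simp
    ring

/-- Away from `P = -1`, the expression `-1 + 2 / (1 - u₀)` is `P`, the square of `exp (qAtanh q A)`.
-/
theorem isLogUZero_qAtanh {q : ℂ} (hq : ‖q‖ < 1) : IsLogUZero q fun A => 2 * qAtanh q A := by
  refine ⟨(differentiableOn_qAtanh hq).const_mul 2, by simp [qAtanh], fun A hA hS => ?_⟩
  have hP : ratioP q A + 1 ≠ 0 := fun h => hS (by
    rw [Set.mem_ofPred_eq]; linear_combination h)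
  have h1 : cexp (2 * qAtanh q A) = ratioP q A := by
    rw [ratioP, ← cexp_qAtanh hq hA, ← Complex.exp_nat_mul]
    norm_num
  have h2 : 1 - uZero q A = 2 / (ratioP q A + 1) := by
    rw [uZero]; field_simp; ring
  change cexp (2 * qAtanh q A) = -1 + 2 / (1 - uZero q A)
  rw [h1, h2]
  field_simp
  ring

theorem isLogUZero_eqOn {q : ℂ} (hq : ‖q‖ < 1) {L : ℂ → ℂ} (hL : IsLogUZero q L) {A : ℂ}
    (hA : ‖A‖ < 1) : L A = 2 * qAtanh q A := by
  obtain ⟨d1, z1, c1⟩ := hL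
  obtain ⟨d2, z2, c2⟩ := isLogUZero_qAtanh hq
  have hU : {A : ℂ | ‖A‖ < 1} = Metric.ball 0 1 := by ext; simp
  have ho : IsOpen {A : ℂ | ‖A‖ < 1} := hU ▸ Metric.isOpen_ball
  have h0 : (0 : ℂ) ∈ {A : ℂ | ‖A‖ < 1} := by simp
  refine eqOn_of_cexp_eventuallyEq ho (hU ▸ (convex_ball 0 1).isPreconnected) h0 d1 d2
    (z1.trans z2.symm) ?_ hA
  have hc : ContinuousAt (fun A => cexp (2 * qAtanh q A)) 0 :=
    (d2.differentiableAt (ho.mem_nhds h0)).continuousAt.cexp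
  -- Near `A = 0` the value `P` is close to `1`, so the exceptional set is avoided.
  have hne : ∀ᶠ A in 𝓝 (0 : ℂ), cexp (2 * qAtanh q A) ≠ -1 := by
    refine hc.eventually_ne ?_
    rw [show 2 * qAtanh q 0 = 0 from z2, Complex.exp_zero]
    norm_num
  filter_upwards [hne, ho.mem_nhds h0] with A h1 h2
  have hS : A ∉ {A | ratioP q A = -1} := fun h => h1 (by
    rw [← h, ratioP, ← cexp_qAtanh hq h2, ← Complex.exp_nat_mul]
    norm_num)
  rw [c1 A h2 hS, c2 A h2 hS]

/-! ### The logarithm on the strip. -/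

theorem zetaArg_linear (K u : ℂ) : zetaArg K u = Real.pi / (2 * K) * u := by
  rw [zetaArg]; ring

theorem differentiable_zetaArg (K : ℂ) : Differentiable ℂ (zetaArg K) := by
  have : zetaArg K = fun u => Real.pi / (2 * K) * u := funext (zetaArg_linear K)
  rw [this]
  exact differentiable_id.const_mul _

theorem isOpen_uStrip (z K : ℂ) : IsOpen (uStrip z K) :=
  isOpen_lt (Complex.continuous_im.comp (differentiable_zetaArg K).continuous).abs continuous_const

theorem isPreconnected_uStrip (z K : ℂ) : IsPreconnected (uStrip z K) := by
  refine Convex.isPreconnected ?_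
  have h : IsLinearMap ℝ fun u => (zetaArg K u).im :=
    ⟨fun u v => by simp only [zetaArg_linear, mul_add, Complex.add_im],
      fun c u => by
        simp only [zetaArg_linear, Complex.real_smul, smul_eq_mul, mul_left_comm _ (c : ℂ),
          Complex.im_ofReal_mul]⟩
  have e : uStrip z K = (fun u => (zetaArg K u).im) ⁻¹' Set.Ioo (-(Real.pi * z.im)) (Real.pi * z.im) := by
    ext u; simp [uStrip, abs_lt]
  rw [e]
  exact (convex_Ioo _ _).is_linear_preimage h

theorem isLogNdSd_qAtanh {z : ℂ} (hz : 0 < z.im) (K : ℂ) : IsLogNdSd z (modulus z) K fun u =>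
    qAtanh (nome z) (rotNome z (-zetaArg K u)) - qAtanh (nome z) (rotNome z (zetaArg K u)) := by
  have hq := norm_nome_lt_one hz
  have hd := differentiable_zetaArg K
  refine ⟨?_, ?_, fun u hu _ => ?_⟩
  · refine ((differentiableOn_qAtanh hq).comp ?_ ?_).sub ((differentiableOn_qAtanh hq).comp ?_ ?_)
    · exact ((hd.neg.const_mul I).cexp.const_mul _).differentiableOn
    · exact fun u hu => norm_rotNome_lt_one (by simpa using! hu)
    · exact ((hd.const_mul I).cexp.const_mul _).differentiableOn
    · exact fun u hu => norm_rotNome_lt_one hu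
  · simp [zetaArg]
  · have h1 := norm_rotNome_lt_one hu
    have h2 : ‖rotNome z (-zetaArg K u)‖ < 1 := norm_rotNome_lt_one (by simpa using! hu)
    change cexp (_ - _) = jacobiNd z K u + modulus z * jacobiSd z K u
    rw [jacobiNd_add_mul_jacobiSd hz hu, theta_quotient_eq hz, Complex.exp_sub, cexp_qAtanh hq h1,
      cexp_qAtanh hq h2, div_div_div_eq]
    ring

theorem isLogNdSd_eqOn {z K : ℂ} (hz : 0 < z.im) {M : ℂ → ℂ} (hM : IsLogNdSd z (modulus z) K M)
    {u : ℂ} (hu : u ∈ uStrip z K) : M u =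
      qAtanh (nome z) (rotNome z (-zetaArg K u)) - qAtanh (nome z) (rotNome z (zetaArg K u)) := by
  obtain ⟨d1, z1, c1⟩ := hM
  obtain ⟨d2, z2, c2⟩ := isLogNdSd_qAtanh hz K
  have h0 : (0 : ℂ) ∈ uStrip z K := by
    simpa [uStrip, zetaArg] using mul_pos Real.pi_pos hz
  refine eqOn_of_cexp_eventuallyEq (isOpen_uStrip z K) (isPreconnected_uStrip z K) h0 d1 d2
    (z1.trans z2.symm) ?_ hu
  filter_upwards [(isOpen_uStrip z K).mem_nhds h0] with w hw
  rw [c1 w hw (by simp), c2 w hw (by simp)]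

theorem log_uZero_eq {z : ℂ} (hz : 0 < z.im) (K : ℂ) :
    (∃ L : ℂ → ℂ, IsLogUZero (nome z) L) ∧
    (∃ M : ℂ → ℂ, IsLogNdSd z (modulus z) K M) ∧
    ∀ L M : ℂ → ℂ, IsLogUZero (nome z) L → IsLogNdSd z (modulus z) K M →
      ∀ u ∈ uStrip z K, ∀ A : ℂ,
        A = Complex.I * qpow z (1 / 2) * Complex.exp (Complex.I * Real.pi * u / (2 * K)) →
        ‖A‖ < 1 ∧
        Summable (fun n : ℕ => (-1) ^ n * qpow z (n + 1 / 2) *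
          Complex.cos ((2 * n + 1) * (Real.pi / (2 * K)) * u) /
            ((2 * n + 1) * (1 - nome z ^ (2 * n + 1)))) ∧
        L A = -M u + 4 * Complex.I * ∑' n : ℕ, (-1) ^ n * qpow z (n + 1 / 2) *
          Complex.cos ((2 * n + 1) * (Real.pi / (2 * K)) * u) /
            ((2 * n + 1) * (1 - nome z ^ (2 * n + 1))) := by
  have hq := norm_nome_lt_one hz
  refine ⟨⟨_, isLogUZero_qAtanh hq⟩, ⟨_, isLogNdSd_qAtanh hz K⟩, fun L M hL hM u hu A hA => ?_⟩
  have hA' : A = rotNome z (zetaArg K u) := by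
    rw [hA, rotNome, zetaArg]; congr 2; ring
  have hs := hasSum_qAtanh_add hz hu
  simp_rw [zetaArg_linear K u, ← mul_assoc] at hs
  have hn : ‖A‖ < 1 := hA' ▸ norm_rotNome_lt_one hu
  refine ⟨hn, hs.summable, ?_⟩
  rw [hs.tsum_eq, isLogUZero_eqOn hq hL hn, isLogNdSd_eqOn hz hM hu, hA', ← zetaArg_linear,
    mul_div_cancel₀ _ (mul_ne_zero (by norm_num) I_ne_zero)]
  ring

/-! ### Complete elliptic integrals and the Landen transformation -/

/-- The coefficients `(1/2)_n / n!` of `(1 - w) ^ (-1/2)`. -/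
def halfCoeff (n : ℕ) : ℝ := ∏ i ∈ Finset.range n, (2 * (i : ℝ) + 1) / (2 * i + 2)

theorem halfCoeff_succ (n : ℕ) : halfCoeff (n + 1) = halfCoeff n * ((2 * n + 1) / (2 * n + 2)) :=
  Finset.prod_range_succ _ _

theorem halfCoeff_pos (n : ℕ) : 0 < halfCoeff n := Finset.prod_pos fun i _ => by positivity

theorem halfCoeff_le_one (n : ℕ) : halfCoeff n ≤ 1 :=
  Finset.prod_le_one (fun i _ => by positivity) fun i _ => by
    rw [div_le_one (by positivity)]; linarith

theorem ascPochhammer_eval_half (n : ℕ) :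
    (ascPochhammer ℂ n).eval (1 / 2 : ℂ) = n.factorial * halfCoeff n := by
  induction n with
  | zero => simp [halfCoeff]
  | succ n ih =>
    rw [ascPochhammer_succ_eval, ih, halfCoeff_succ, Nat.factorial_succ]
    push_cast
    have : (n : ℂ) + 1 ≠ 0 := Nat.cast_add_one_ne_zero n
    have : 2 * (n : ℂ) + 2 ≠ 0 := by
      rw [show 2 * (n : ℂ) + 2 = 2 * (n + 1) by ring]; exact mul_ne_zero two_ne_zero this
    field_simp
    ring

theorem ascPochhammer_eval_one_eq (n : ℕ) :
    (ascPochhammer ℂ n).eval (1 : ℂ) = n.factorial := by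
  induction n with
  | zero => simp
  | succ n ih =>
    rw [ascPochhammer_succ_eval, ih, Nat.factorial_succ]
    push_cast
    ring

/-- `₂F₁(1/2, 1/2; 1; m)` for real `m`. -/
def ellipticSeries (m : ℝ) : ℝ := ∑' n : ℕ, halfCoeff n ^ 2 * m ^ n

theorem ellipticK_ofReal (x : ℝ) : ellipticK x = (Real.pi / 2 * ellipticSeries (x ^ 2) : ℝ) := by
  rw [ellipticK, ordinaryHypergeometric_eq_tsum, ellipticSeries]
  push_cast
  congr 1
  refine tsum_congr fun n => ?_
  rw [ascPochhammer_eval_half, ascPochhammer_eval_one_eq]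
  have : (n.factorial : ℂ) ≠ 0 := by exact_mod_cast n.factorial_ne_zero
  rw [smul_eq_mul]
  field_simp

theorem summable_ellipticSeries {m : ℝ} (h0 : 0 ≤ m) (h1 : m < 1) :
    Summable fun n : ℕ => halfCoeff n ^ 2 * m ^ n :=
  Summable.of_nonneg_of_le (fun n => by positivity)
    (fun n => mul_le_of_le_one_left (by positivity)
      (pow_le_one₀ (halfCoeff_pos n).le (halfCoeff_le_one n)))
    (summable_geometric_of_lt_one h0 h1)

theorem one_le_ellipticSeries {m : ℝ} (h0 : 0 ≤ m) (h1 : m < 1) : 1 ≤ ellipticSeries m := by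
  have := (summable_ellipticSeries h0 h1).le_tsum 0 fun n _ => by positivity
  rwa [show halfCoeff 0 = 1 from Finset.prod_range_zero _, one_pow, pow_zero, mul_one] at this

theorem ellipticSeries_le {m : ℝ} (h0 : 0 ≤ m) (h1 : m < 1) : ellipticSeries m ≤ (1 - m)⁻¹ := by
  rw [← tsum_geometric_of_lt_one h0 h1]
  exact (summable_ellipticSeries h0 h1).tsum_le_tsum
    (fun n => mul_le_of_le_one_left (by positivity)
      (pow_le_one₀ (halfCoeff_pos n).le (halfCoeff_le_one n)))
    (summable_geometric_of_lt_one h0 h1)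

theorem ellipticSeries_lt {a b : ℝ} (h0 : 0 ≤ a) (hab : a < b) (h1 : b < 1) :
    ellipticSeries a < ellipticSeries b := by
  have hc := halfCoeff_pos
  -- The linear term supplies the strict inequality.
  refine Summable.tsum_lt_tsum (i := 1) (fun n => ?_) ?_
    (summable_ellipticSeries h0 (hab.trans h1)) (summable_ellipticSeries (h0.trans hab.le) h1)
  · have := hc n
    gcongr
  · have := hc 1
    simp only [pow_one]
    gcongr

theorem tendsto_ellipticSeries {u : ℕ → ℝ} (h0 : ∀ n, 0 ≤ u n) (hu : Tendsto u atTop (𝓝 0)) :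
    Tendsto (fun n => ellipticSeries (u n)) atTop (𝓝 1) := by
  have h1 : ∀ᶠ n in atTop, u n < 1 := hu.eventually_lt_const one_pos
  have h2 : Tendsto (fun n => (1 - u n)⁻¹) atTop (𝓝 1) := by
    have := (tendsto_const_nhds (x := (1 : ℝ))).sub hu |>.inv₀ (by norm_num)
    simpa using this
  refine tendsto_of_tendsto_of_tendsto_of_le_of_le' tendsto_const_nhds h2 ?_ ?_
  · filter_upwards [h1] with n hn using one_le_ellipticSeries (h0 n) hn
  · filter_upwards [h1] with n hn using ellipticSeries_le (h0 n) hn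

/-! ### The binomial series and two evaluations of one integral. -/

theorem ringChoose_half (n : ℕ) : Ring.choose (1 / 2 + n - 1 : ℂ) n = halfCoeff n := by
  have h := Ring.factorial_nsmul_multichoose_eq_ascPochhammer (1 / 2 : ℂ) n
  rw [Polynomial.ascPochhammer_smeval_eq_eval, ascPochhammer_eval_half, nsmul_eq_mul] at h
  have : (n.factorial : ℂ) ≠ 0 := by exact_mod_cast n.factorial_ne_zero
  rw [Ring.choose, show (1 / 2 + n - 1 - n + 1 : ℂ) = 1 / 2 by ring]
  exact mul_left_cancel₀ this h

theorem hasSum_halfCoeff {w : ℂ} (hw : ‖w‖ < 1) :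
    HasSum (fun n : ℕ => (halfCoeff n : ℂ) * w ^ n) (1 / (1 - w) ^ (1 / 2 : ℂ)) := by
  have h := (one_div_one_sub_cpow_hasFPowerSeriesOnBall_zero (1 / 2)).hasSum (y := w)
    (by simpa [enorm_eq_nnnorm, ← NNReal.coe_lt_coe] using hw)
  simp only [FormalMultilinearSeries.ofScalars_apply_eq, zero_add, ringChoose_half,
    smul_eq_mul] at h
  exact h

/-- `1 - w` has positive real part, so it avoids the branch cut and the principal root commutes with
conjugation. -/
theorem cpow_half_mul_conj {w : ℂ} (hw : ‖w‖ < 1) :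
    (1 - w) ^ (1 / 2 : ℂ) * (1 - (starRingEnd ℂ) w) ^ (1 / 2 : ℂ) = (‖1 - w‖ : ℝ) := by
  have hre : 0 < (1 - w).re := by
    have := (Complex.re_le_norm w).trans_lt hw
    simpa using this
  have harg : (1 - w).arg ≠ Real.pi := by
    intro h
    rw [Complex.arg_eq_pi_iff] at h
    linarith
  have h1 : (1 - (starRingEnd ℂ) w) ^ (1 / 2 : ℂ) = (starRingEnd ℂ) ((1 - w) ^ (1 / 2 : ℂ)) := by
    have h := Complex.conj_cpow (1 - w) (1 / 2) harg
    simpa [map_ofNat] using h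
  rw [h1, Complex.mul_conj, Complex.normSq_eq_norm_sq]
  congr 1
  have : (1 / 2 : ℂ) = ((1 / 2 : ℝ) : ℂ) := by push_cast; ring
  rw [this, Complex.norm_cpow_real, ← Real.sqrt_eq_rpow, Real.sq_sqrt (norm_nonneg _)]

theorem integral_cexp_two_mul (m : ℤ) :
    ∫ φ in (0 : ℝ)..Real.pi, cexp (2 * m * I * φ) = if m = 0 then (Real.pi : ℂ) else 0 := by
  split_ifs with h
  · simp [h]
  · have hm : (2 * m * I : ℂ) ≠ 0 := by
      simp [h]
    rw [integral_exp_mul_complex hm, show (2 * m * I * Real.pi : ℂ) = m * (2 * Real.pi * I) by ring,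
      Complex.exp_int_mul_two_pi_mul_I]
    simp

/-- With `w = -k e^(2iφ)` the integrand is `(1 - w)^(-1/2)` times its conjugate; by orthogonality
only the diagonal of the double series survives. -/
theorem integral_inv_norm_eq_ellipticSeries_sq {k : ℝ} (h0 : 0 ≤ k) (h1 : k < 1) :
    ∫ φ in (0 : ℝ)..Real.pi, (‖1 + k * cexp (2 * I * φ)‖⁻¹ : ℂ) =
      Real.pi * ellipticSeries (k ^ 2) := by
  let F : ℕ × ℕ → ℝ → ℂ := fun c φ =>
    (halfCoeff c.1 * (-k * cexp (2 * I * φ)) ^ c.1) * (halfCoeff c.2 * (-k * cexp (-(2 * I * φ))) ^ c.2)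
  have hnorm (φ : ℝ) : ‖cexp (2 * I * φ)‖ = 1 := by
    rw [Complex.norm_exp]; simp
  have hnorm' (φ : ℝ) : ‖cexp (-(2 * I * φ))‖ = 1 := by
    rw [Complex.norm_exp]; simp
  have hk : ‖(k : ℂ)‖ = k := by rw [Complex.norm_real, Real.norm_of_nonneg h0]
  have hgeo := summable_geometric_of_lt_one h0 h1
  have hb : Summable fun c : ℕ × ℕ => k ^ c.1 * k ^ c.2 :=
    hgeo.mul_of_nonneg hgeo (fun _ => by positivity) (fun _ => by positivity)
  have hcn (n : ℕ) : ‖(halfCoeff n : ℂ)‖ ≤ 1 := by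
    rw [Complex.norm_real, Real.norm_of_nonneg (halfCoeff_pos n).le]; exact halfCoeff_le_one n
  have hFb (c : ℕ × ℕ) (φ : ℝ) : ‖F c φ‖ ≤ k ^ c.1 * k ^ c.2 := by
    simp only [F, norm_mul, norm_pow, norm_neg, hnorm, hnorm', hk, mul_one]
    have := hcn c.1
    have := hcn c.2
    exact mul_le_mul (mul_le_of_le_one_left (by positivity) ‹_›)
      (mul_le_of_le_one_left (by positivity) ‹_›) (by positivity) (by positivity)
  have hsum (φ : ℝ) : HasSum (fun c => F c φ) (‖1 + k * cexp (2 * I * φ)‖⁻¹ : ℂ) := by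
    have w1 : ‖-k * cexp (2 * I * φ)‖ < 1 := by rw [norm_mul, norm_neg, hnorm, hk, mul_one]; exact h1
    have w2 : ‖-k * cexp (-(2 * I * φ))‖ < 1 := by
      rw [norm_mul, norm_neg, hnorm', hk, mul_one]; exact h1
    have hs : Summable fun c : ℕ × ℕ => F c φ := hb.of_norm_bounded fun c => hFb c φ
    have := HasSum.mul (hasSum_halfCoeff w1) (hasSum_halfCoeff w2) hs
    convert! this using 1
    have hconj : (starRingEnd ℂ) (-k * cexp (2 * I * φ)) = -k * cexp (-(2 * I * φ)) := by
      rw [map_mul, ← Complex.exp_conj]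
      simp [map_ofNat]
    rw [div_mul_div_comm, ← hconj, cpow_half_mul_conj w1]
    simp
  have hint := intervalIntegral.hasSum_integral_of_dominated_convergence
    (μ := MeasureTheory.volume) (a := 0) (b := Real.pi) (F := F)
    (f := fun φ => (‖1 + k * cexp (2 * I * φ)‖⁻¹ : ℂ)) (fun c _ => k ^ c.1 * k ^ c.2)
    (fun c => (by fun_prop : Continuous (F c)).aestronglyMeasurable)
    (fun c => Eventually.of_forall fun φ _ => hFb c φ)
    (Eventually.of_forall fun φ _ => hb) (by simp)
    (Eventually.of_forall fun φ _ => hsum φ)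
  have hF (c : ℕ × ℕ) : ∫ φ in (0 : ℝ)..Real.pi, F c φ =
      if c.1 = c.2 then (Real.pi : ℂ) * (halfCoeff c.1 ^ 2 * (k ^ 2) ^ c.1) else 0 := by
    have e (φ : ℝ) : F c φ = (halfCoeff c.1 * halfCoeff c.2 * (-k) ^ (c.1 + c.2)) *
        cexp (2 * ((c.1 - c.2 : ℤ) : ℂ) * I * φ) := by
      have : cexp (2 * ((c.1 - c.2 : ℤ) : ℂ) * I * φ) =
          cexp (2 * I * φ) ^ c.1 * cexp (-(2 * I * φ)) ^ c.2 := by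
        rw [← Complex.exp_nat_mul, ← Complex.exp_nat_mul, ← Complex.exp_add]
        congr 1
        push_cast
        ring
      rw [this]
      simp only [F]
      ring
    simp_rw [e]
    rw [intervalIntegral.integral_const_mul, integral_cexp_two_mul]
    by_cases h : c.1 = c.2
    · rw [h, if_pos (by simp), if_pos rfl]
      have : (-(k : ℂ)) ^ (c.2 + c.2) = (k ^ 2) ^ c.2 := by
        rw [← two_mul, pow_mul, neg_sq]
      rw [this]
      ring
    · rw [if_neg h, if_neg (by omega), mul_zero]
  simp_rw [hF] at hint
  have hdiag : Function.Injective fun n : ℕ => (n, n) := fun a b h => (Prod.mk.inj h).1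
  rw [← hdiag.hasSum_iff] at hint
  · rw [← hint.tsum_eq, ellipticSeries]
    push_cast
    rw [← tsum_mul_left]
    exact tsum_congr fun n => by simp
  · rintro ⟨a, b⟩ h
    exact if_neg fun hab => h ⟨a, by simp_all⟩

/-- The same integral, now from `‖1 + k e^(2iφ)‖² = (1 + k)² (1 - m sin² φ)` and Wallis' integrals.
-/
theorem integral_inv_norm_eq_ellipticSeries {k : ℝ} (h0 : 0 ≤ k) (h1 : k < 1) :
    ∫ φ in (0 : ℝ)..Real.pi, (‖1 + k * cexp (2 * I * φ)‖⁻¹ : ℂ) =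
      Real.pi * ((1 + k)⁻¹ * ellipticSeries (4 * k / (1 + k) ^ 2)) := by
  set m := 4 * k / (1 + k) ^ 2 with hm
  have hm0 : 0 ≤ m := by positivity
  have hm1 : m < 1 := by
    rw [hm, div_lt_one (by positivity)]
    nlinarith [mul_pos (sub_pos.mpr h1) (sub_pos.mpr h1)]
  let F : ℕ → ℝ → ℂ := fun n φ => (((1 + k)⁻¹ * (halfCoeff n * m ^ n)) * Real.sin φ ^ (2 * n) : ℝ)
  have hgeo := summable_geometric_of_lt_one hm0 hm1
  have hFb (n : ℕ) (φ : ℝ) : ‖F n φ‖ ≤ m ^ n := by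
    have c0 := halfCoeff_pos n
    have c1 := halfCoeff_le_one n
    have k1 : (1 + k)⁻¹ ≤ 1 := inv_le_one_of_one_le₀ (by linarith)
    have s1 : Real.sin φ ^ (2 * n) ≤ 1 := by
      rw [pow_mul]; exact pow_le_one₀ (sq_nonneg _) (Real.sin_sq_le_one φ)
    have s0 : 0 ≤ Real.sin φ ^ (2 * n) := by rw [pow_mul]; positivity
    simp only [F]
    rw [Complex.norm_real, Real.norm_of_nonneg (by positivity)]
    refine (mul_le_of_le_one_right (by positivity) s1).trans ?_
    refine (mul_le_of_le_one_left (by positivity) k1).trans ?_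
    exact mul_le_of_le_one_left (by positivity) c1
  have hsum (φ : ℝ) : HasSum (fun n => F n φ) (‖1 + k * cexp (2 * I * φ)‖⁻¹ : ℂ) := by
    have hs0 : 0 ≤ m * Real.sin φ ^ 2 := by positivity
    have hs1 : m * Real.sin φ ^ 2 < 1 :=
      (mul_le_of_le_one_right hm0 (Real.sin_sq_le_one φ)).trans_lt hm1
    have w1 : ‖((m * Real.sin φ ^ 2 : ℝ) : ℂ)‖ < 1 := by
      rwa [Complex.norm_real, Real.norm_of_nonneg hs0]
    have := (hasSum_halfCoeff w1).mul_left ((1 + k)⁻¹ : ℂ)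
    convert! this using 1
    · ext n
      simp only [F]
      push_cast
      ring
    · have hn : ‖1 + k * cexp (2 * I * φ)‖ = (1 + k) * Real.sqrt (1 - m * Real.sin φ ^ 2) := by
        rw [Complex.norm_def, ← Real.sqrt_sq (by positivity : 0 ≤ 1 + k), ← Real.sqrt_mul (by positivity)]
        congr 1
        have e : (1 + k * cexp (2 * I * φ) : ℂ) =
            ((1 + k * Real.cos (2 * φ) : ℝ) : ℂ) + ((k * Real.sin (2 * φ) : ℝ) : ℂ) * I := by
          rw [show 2 * I * (φ : ℂ) = ((2 * φ : ℝ) : ℂ) * I by push_cast; ring, Complex.exp_mul_I,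
            ← Complex.ofReal_cos, ← Complex.ofReal_sin]
          push_cast
          ring
        have hk : (1 + k) ^ 2 * (1 - m * Real.sin φ ^ 2) = (1 + k) ^ 2 - 4 * k * Real.sin φ ^ 2 := by
          rw [hm]; field_simp
        rw [e, Complex.normSq_add_mul_I, hk, Real.cos_two_mul, Real.sin_two_mul]
        have := Real.sin_sq_add_cos_sq φ
        linear_combination (4 * k ^ 2 * Real.cos φ ^ 2 + 4 * k) * this
      have e2 : (1 - ((m * Real.sin φ ^ 2 : ℝ) : ℂ)) ^ (1 / 2 : ℂ) =
          (Real.sqrt (1 - m * Real.sin φ ^ 2) : ℝ) := by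
        rw [Real.sqrt_eq_rpow, Complex.ofReal_cpow (by linarith)]
        push_cast
        ring_nf
      rw [hn, e2]
      push_cast
      rw [mul_inv, one_div]
  have hint := intervalIntegral.hasSum_integral_of_dominated_convergence
    (μ := MeasureTheory.volume) (a := 0) (b := Real.pi) (F := F)
    (f := fun φ => (‖1 + k * cexp (2 * I * φ)‖⁻¹ : ℂ)) (fun n _ => m ^ n)
    (fun n => (by fun_prop : Continuous (F n)).aestronglyMeasurable)
    (fun n => Eventually.of_forall fun φ _ => hFb n φ)
    (Eventually.of_forall fun φ _ => hgeo) (by simp)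
    (Eventually.of_forall fun φ _ => hsum φ)
  have hF (n : ℕ) : ∫ φ in (0 : ℝ)..Real.pi, F n φ =
      Real.pi * ((1 + k)⁻¹ * (halfCoeff n ^ 2 * m ^ n) : ℝ) := by
    simp only [F]
    rw [intervalIntegral.integral_ofReal, intervalIntegral.integral_const_mul,
      integral_sin_pow_even, ← halfCoeff]
    push_cast
    ring
  simp_rw [hF] at hint
  rw [← hint.tsum_eq, tsum_mul_left, ← Complex.ofReal_tsum, tsum_mul_left, ← ellipticSeries]
  push_cast
  rfl

/-- **Landen's transformation**. -/
theorem ellipticSeries_landen {k : ℝ} (h0 : 0 ≤ k) (h1 : k < 1) :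
    ellipticSeries (4 * k / (1 + k) ^ 2) = (1 + k) * ellipticSeries (k ^ 2) := by
  have h := (integral_inv_norm_eq_ellipticSeries_sq h0 h1).symm.trans
    (integral_inv_norm_eq_ellipticSeries h0 h1)
  have hpi : (Real.pi : ℂ) ≠ 0 := by exact_mod_cast Real.pi_ne_zero
  have h2 := mul_left_cancel₀ hpi h
  have h3 : ellipticSeries (k ^ 2) = (1 + k)⁻¹ * ellipticSeries (4 * k / (1 + k) ^ 2) := by
    exact_mod_cast h2
  rw [h3, mul_inv_cancel_left₀ (by positivity)]

/-! ### Theta constants -/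

theorem qpow_quarter_sq (z : ℂ) : qpow z (1 / 4) ^ 2 = cexp (Real.pi * I * z) := by
  rw [qpow, ← Complex.exp_nat_mul]; congr 1; push_cast; ring

theorem qpow_two_mul_quarter_sq (z : ℂ) : qpow (2 * z) (1 / 4) ^ 2 = cexp (2 * Real.pi * I * z) := by
  rw [qpow_quarter_sq]; congr 1; ring

theorem theta3_zero_sq {z : ℂ} (hz : 0 < z.im) :
    theta3 z 0 ^ 2 = theta3 (2 * z) 0 ^ 2 + theta2 (2 * z) 0 ^ 2 := by
  have h := jacobiTheta₂_mul 0 0 (τ := 2 * z) (by simpa using hz)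
  rw [theta3, theta3, theta2, mul_pow, mul_pow, qpow_two_mul_quarter_sq, sq]
  simp only [zero_div, zero_add, sub_zero, mul_zero, Complex.exp_zero, one_pow, mul_one] at h ⊢
  rw [h, show Real.pi * I * (2 * z) = 2 * Real.pi * I * z by ring]
  ring

theorem theta4_zero_sq {z : ℂ} (hz : 0 < z.im) :
    theta4 z 0 ^ 2 = theta3 (2 * z) 0 ^ 2 - theta2 (2 * z) 0 ^ 2 := by
  have h := jacobiTheta₂_mul (1 / 2) (1 / 2) (τ := 2 * z) (by simpa using hz)
  have hp : ∀ v, jacobiTheta₂ (1 / 2 + 1 / 2 + v) (2 * (2 * z)) = jacobiTheta₂ v (2 * (2 * z)) := by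
    intro v
    rw [← jacobiTheta₂_add_left v]; congr 1; ring
  have hp0 := hp 0
  rw [add_zero] at hp0
  have he : cexp (2 * Real.pi * I * (1 / 2) + Real.pi * I * (2 * z)) =
      -cexp (2 * Real.pi * I * z) := by
    rw [Complex.exp_add, show 2 * Real.pi * I * (1 / 2) = Real.pi * I by ring, Complex.exp_pi_mul_I,
      neg_one_mul, show Real.pi * I * (2 * z) = 2 * Real.pi * I * z by ring]
  rw [hp, hp0, he, sub_self] at h
  rw [theta4, theta3, theta2, mul_pow, mul_pow, qpow_two_mul_quarter_sq, sq]
  simp only [zero_div, zero_add, mul_zero, Complex.exp_zero, one_pow, mul_one] at h ⊢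
  rw [h]
  ring

theorem theta2_zero_sq {z : ℂ} (hz : 0 < z.im) :
    theta2 z 0 ^ 2 = 2 * theta2 (2 * z) 0 * theta3 (2 * z) 0 := by
  have h := jacobiTheta₂_mul z z (τ := 2 * z) (by simpa using hz)
  -- The odd half contains a theta value at a full quasi-period; reducing it to `0` makes the two
  -- halves equal, whence the factor `2`.
  have hq := jacobiTheta₂_add_left' 0 (2 * (2 * z))
  have e : cexp (Real.pi * I * z) * cexp (2 * Real.pi * I * z + Real.pi * I * (2 * z)) *
      cexp (-Real.pi * I * (2 * (2 * z))) = qpow (2 * z) (1 / 4) := by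
    rw [qpow, ← Complex.exp_add, ← Complex.exp_add]; congr 1; ring
  have e' : cexp (Real.pi * I * z) = qpow (2 * z) (1 / 4) := by
    rw [qpow]; congr 1; ring
  rw [theta2, theta2, theta3, mul_pow, mul_pow, qpow_quarter_sq, sq]
  rw [show z + z + 2 * z = 2 * (2 * z) by ring, ← two_mul, sub_self] at h
  simp only [zero_div, zero_add, mul_zero, add_zero, Complex.exp_zero, mul_one] at h hq ⊢
  rw [sq, h, hq]
  linear_combination (jacobiTheta₂ 0 (2 * (2 * z)) * jacobiTheta₂ (2 * z) (2 * (2 * z))) * (e + e')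

/-- `∑ exp (-π t n ^ 2)`. -/
def theta3R (t : ℝ) : ℝ := ∑' n : ℤ, Real.exp (-Real.pi * t * n ^ 2)

/-- `∑ exp (-π t (n + 1 / 2) ^ 2)`. -/
def theta2R (t : ℝ) : ℝ := ∑' n : ℤ, Real.exp (-Real.pi * t * (n + 1 / 2) ^ 2)

theorem theta3_ofReal_mul_I (t : ℝ) : theta3 ((t / 2 : ℝ) * I) 0 = theta3R t := by
  rw [theta3_eq_tsum, theta3R, Complex.ofReal_tsum]
  refine tsum_congr fun n => ?_
  rw [mul_zero, Complex.exp_zero, mul_one, qpow, Complex.ofReal_exp]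
  congr 1
  push_cast
  linear_combination (Real.pi * t * n ^ 2 : ℂ) * I_sq

theorem theta2_ofReal_mul_I (t : ℝ) : theta2 ((t / 2 : ℝ) * I) 0 = theta2R t := by
  rw [theta2_eq_tsum, theta2R, Complex.ofReal_tsum]
  refine tsum_congr fun n => ?_
  rw [mul_zero, Complex.exp_zero, mul_one, qpow, Complex.ofReal_exp]
  congr 1
  push_cast
  linear_combination (Real.pi * t * (n + 1 / 2) ^ 2 : ℂ) * I_sq

/-! ### Positivity and limits of the real theta constants. -/

theorem summable_theta3R {t : ℝ} (ht : 0 < t) :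
    Summable fun n : ℤ => Real.exp (-Real.pi * t * n ^ 2) := by
  have h := ((summable_jacobiTheta₂_term_iff 0 (t * I)).mpr (by simpa)).norm
  refine h.congr fun n => ?_
  rw [norm_jacobiTheta₂_term]
  simp
  ring

theorem summable_theta2R {t : ℝ} (ht : 0 < t) :
    Summable fun n : ℤ => Real.exp (-Real.pi * t * (n + 1 / 2) ^ 2) := by
  have h := ((summable_jacobiTheta₂_term_iff (t / 2 * I) (t * I)).mpr (by simpa)).norm.mul_left
    (Real.exp (-Real.pi * t / 4))
  refine h.congr fun n => ?_
  rw [norm_jacobiTheta₂_term, ← Real.exp_add]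
  congr 1
  simp
  ring

theorem theta2R_pos {t : ℝ} (ht : 0 < t) : 0 < theta2R t :=
  (summable_theta2R ht).tsum_pos (fun _ => (Real.exp_pos _).le) 0 (Real.exp_pos _)

theorem theta3R_pos {t : ℝ} (ht : 0 < t) : 0 < theta3R t :=
  (summable_theta3R ht).tsum_pos (fun _ => (Real.exp_pos _).le) 0 (Real.exp_pos _)

theorem tendsto_exp_neg_mul {c : ℝ} (hc : 0 < c) :
    Tendsto (fun t : ℝ => Real.exp (-Real.pi * t * c)) atTop (𝓝 0) := by
  have h : Tendsto (fun t : ℝ => (Real.pi * c) * t) atTop atTop :=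
    tendsto_id.const_mul_atTop (by positivity)
  refine (Real.tendsto_exp_neg_atTop_nhds_zero.comp h).congr fun t => ?_
  simp only [Function.comp]
  congr 1
  ring

theorem tendsto_theta2R : Tendsto theta2R atTop (𝓝 0) := by
  rw [← tsum_zero (α := ℝ) (β := ℤ)]
  refine tendsto_tsum_of_dominated_convergence (summable_theta2R one_pos) (fun n => ?_) ?_
  · refine tendsto_exp_neg_mul ?_
    have : (n : ℝ) + 1 / 2 ≠ 0 := by
      intro h
      have h2 : (2 * n + 1 : ℤ) = 0 := by
        have : (2 * n + 1 : ℝ) = 0 := by linear_combination 2 * h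
        exact_mod_cast this
      omega
    positivity
  · filter_upwards [eventually_ge_atTop 1] with t ht n
    rw [Real.norm_of_nonneg (Real.exp_pos _).le, Real.exp_le_exp]
    have : 0 ≤ Real.pi * ((n : ℝ) + 1 / 2) ^ 2 := by positivity
    nlinarith

theorem tendsto_theta3R : Tendsto theta3R atTop (𝓝 1) := by
  rw [← tsum_ite_eq (0 : ℤ) (fun _ => (1 : ℝ))]
  refine tendsto_tsum_of_dominated_convergence (summable_theta3R one_pos) (fun n => ?_) ?_
  · split_ifs with h
    · simp [h]
    · exact tendsto_exp_neg_mul (by positivity)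
  · filter_upwards [eventually_ge_atTop 1] with t ht n
    rw [Real.norm_of_nonneg (Real.exp_pos _).le, Real.exp_le_exp]
    have : 0 ≤ Real.pi * (n : ℝ) ^ 2 := by positivity
    nlinarith

theorem im_half_mul_I_pos {t : ℝ} (ht : 0 < t) : 0 < (((t / 2 : ℝ) : ℂ) * I).im := by
  simpa using ht

theorem two_mul_half_mul_I (t : ℝ) :
    2 * (((t / 2 : ℝ) : ℂ) * I) = ((2 * t / 2 : ℝ) : ℂ) * I := by
  push_cast; ring

theorem theta3R_sq {t : ℝ} (ht : 0 < t) :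
    theta3R t ^ 2 = theta3R (2 * t) ^ 2 + theta2R (2 * t) ^ 2 := by
  have h := theta3_zero_sq (im_half_mul_I_pos ht)
  rw [two_mul_half_mul_I, theta3_ofReal_mul_I, theta3_ofReal_mul_I, theta2_ofReal_mul_I] at h
  exact_mod_cast h

theorem theta2R_sq {t : ℝ} (ht : 0 < t) :
    theta2R t ^ 2 = 2 * theta2R (2 * t) * theta3R (2 * t) := by
  have h := theta2_zero_sq (im_half_mul_I_pos ht)
  rw [two_mul_half_mul_I, theta3_ofReal_mul_I, theta2_ofReal_mul_I, theta2_ofReal_mul_I] at h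
  exact_mod_cast h

/-! ### The inversion `t ↦ 1/t`. -/

theorem neg_I_mul_cpow_half {t : ℝ} (ht : 0 < t) :
    (-I * (t * I)) ^ (1 / 2 : ℂ) = (Real.sqrt t : ℝ) := by
  rw [show -I * (t * I) = (t : ℂ) by linear_combination (-t : ℂ) * I_sq, Real.sqrt_eq_rpow,
    Complex.ofReal_cpow ht.le]
  push_cast
  rfl

theorem neg_one_div_mul_I (t : ℝ) : -1 / (t * I) = ((1 / t : ℝ) : ℂ) * I := by
  rw [neg_div, one_div, mul_inv, Complex.inv_I]
  push_cast
  ring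

theorem two_mul_half_mul_I' (t : ℝ) : 2 * (((t / 2 : ℝ) : ℂ) * I) = t * I := by
  push_cast; ring

theorem theta3R_modular {t : ℝ} (ht : 0 < t) : theta3R t = theta3R (1 / t) / Real.sqrt t := by
  have h := jacobiTheta₂_functional_equation 0 (t * I)
  rw [neg_I_mul_cpow_half ht, neg_one_div_mul_I] at h
  have a := theta3_ofReal_mul_I t
  have b := theta3_ofReal_mul_I (1 / t)
  rw [theta3, two_mul_half_mul_I', zero_div] at a b
  rw [zero_div, a, b] at h
  have h' : (theta3R t : ℂ) = theta3R (1 / t) / (Real.sqrt t : ℝ) := by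
    rw [h]
    simp
    ring
  exact_mod_cast h'

/-- The modular transformation exchanging `θ₂` and `θ₄`. -/
theorem theta2R_modular {t : ℝ} (ht : 0 < t) :
    (theta2R t : ℂ) = theta4 (((1 / t / 2 : ℝ) : ℂ) * I) 0 / (Real.sqrt t : ℝ) := by
  have htc : (t : ℂ) ≠ 0 := by exact_mod_cast ht.ne'
  have h := jacobiTheta₂_functional_equation (((t / 2 : ℝ) : ℂ) * I) (t * I)
  rw [neg_I_mul_cpow_half ht, neg_one_div_mul_I] at h
  rw [← theta2_ofReal_mul_I, theta2, theta4, two_mul_half_mul_I', two_mul_half_mul_I', zero_div,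
    zero_add, h, zero_add]
  have e1 : ((t / 2 : ℝ) : ℂ) * I / (t * I) = 1 / 2 := by
    push_cast; field_simp [I_ne_zero]
  have e2 : qpow (((t / 2 : ℝ) : ℂ) * I) (1 / 4) *
      cexp (-Real.pi * I * (((t / 2 : ℝ) : ℂ) * I) ^ 2 / (t * I)) = 1 := by
    rw [qpow, ← Complex.exp_add]
    convert! Complex.exp_zero using 2
    push_cast
    field_simp [I_ne_zero]
    ring
  rw [e1, mul_zero, Complex.exp_zero, mul_one]
  linear_combination (jacobiTheta₂ (1 / 2) (((1 / t : ℝ) : ℂ) * I) / (Real.sqrt t : ℝ)) * e2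

/-- **Jacobi's quartic identity**, with `θ₄` expressed through `θ₂` at the inverted argument. -/
theorem theta3R_pow_four {t : ℝ} (ht : 0 < t) :
    theta3R t ^ 4 = theta2R t ^ 4 + (theta2R (1 / t) ^ 2 / t) ^ 2 := by
  have hz := im_half_mul_I_pos ht
  have h4 := theta4_zero_sq hz
  have hm := theta2R_modular (t := 1 / t) (by positivity)
  rw [one_div_one_div] at hm
  have hs : ((Real.sqrt (1 / t) : ℝ) : ℂ) ^ 2 = 1 / t := by
    rw [← Complex.ofReal_pow, Real.sq_sqrt (by positivity)]; push_cast; rfl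
  have h5 : theta4 (((t / 2 : ℝ) : ℂ) * I) 0 ^ 2 = (theta2R (1 / t) ^ 2 / t : ℝ) := by
    have hs0 : ((Real.sqrt (1 / t) : ℝ) : ℂ) ≠ 0 := by
      exact_mod_cast (Real.sqrt_pos.mpr (by positivity : 0 < 1 / t)).ne'
    rw [← (eq_div_iff hs0).mp hm, mul_pow, hs]
    push_cast
    ring
  rw [h5, two_mul_half_mul_I, theta3_ofReal_mul_I, theta2_ofReal_mul_I] at h4
  have h6 : theta2R (1 / t) ^ 2 / t = theta3R (2 * t) ^ 2 - theta2R (2 * t) ^ 2 := by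
    exact_mod_cast h4
  have h3 := theta3R_sq ht
  have h2 := theta2R_sq ht
  rw [h6]
  -- With `a = θ₃(2t)` and `b = θ₂(2t)` this is `(a² + b²)² = (2ab)² + (a² - b²)²`.
  linear_combination (theta3R t ^ 2 + theta3R (2 * t) ^ 2 + theta2R (2 * t) ^ 2) * h3 -
    (theta2R t ^ 2 + 2 * theta2R (2 * t) * theta3R (2 * t)) * h2

/-- The modulus `θ₂² / θ₃²` of nome `exp (-π t)`. -/
def modulusR (t : ℝ) : ℝ := theta2R t ^ 2 / theta3R t ^ 2

theorem modulus_ofReal_mul_I (t : ℝ) : modulus ((t / 2 : ℝ) * I) = modulusR t := by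
  rw [modulus, theta2_ofReal_mul_I, theta3_ofReal_mul_I, modulusR]
  push_cast
  rfl

theorem modulusR_pos {t : ℝ} (ht : 0 < t) : 0 < modulusR t := by
  have := theta2R_pos ht
  have := theta3R_pos ht
  unfold modulusR
  positivity

/-- Jacobi's quartic identity divided by `θ₃⁴`: the complementary modulus is the modulus at `1/t`.
-/
theorem one_sub_modulusR_sq {t : ℝ} (ht : 0 < t) : 1 - modulusR t ^ 2 = modulusR (1 / t) ^ 2 := by
  have h := theta3R_pow_four ht
  have h3 := theta3R_pos ht
  have h3' := theta3R_pos (t := 1 / t) (by positivity)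
  have hm : theta3R t ^ 2 * t = theta3R (1 / t) ^ 2 := by
    rw [theta3R_modular ht, div_pow, Real.sq_sqrt ht.le]
    field_simp
  rw [modulusR, modulusR, ← hm]
  field_simp
  field_simp at h
  linear_combination h

theorem modulusR_lt_one {t : ℝ} (ht : 0 < t) : modulusR t < 1 := by
  have h := one_sub_modulusR_sq ht
  have h1 := modulusR_pos (t := 1 / t) (by positivity)
  have h2 := modulusR_pos ht
  nlinarith

/-- Doubling `t` is a Landen step on the modulus, and both numerator and denominator acquire the
factor `1 + modulusR (2 * t)`. -/
theorem ellipticSeries_modulusR_div {t : ℝ} (ht : 0 < t) :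
    ellipticSeries (modulusR t ^ 2) / theta3R t ^ 2 =
      ellipticSeries (modulusR (2 * t) ^ 2) / theta3R (2 * t) ^ 2 := by
  have ht2 : 0 < 2 * t := by positivity
  have h3 := theta3R_pos ht2
  have h2 := theta2R_pos ht2
  have hl := ellipticSeries_landen (modulusR_pos ht2).le (modulusR_lt_one ht2)
  have e : modulusR t ^ 2 = 4 * modulusR (2 * t) / (1 + modulusR (2 * t)) ^ 2 := by
    rw [modulusR, modulusR, theta2R_sq ht, theta3R_sq ht]
    field_simp
    ring
  have e3 : theta3R t ^ 2 = theta3R (2 * t) ^ 2 * (1 + modulusR (2 * t)) := by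
    rw [theta3R_sq ht, modulusR]
    field_simp
  have hk := modulusR_pos ht2
  rw [e, hl, e3]
  field_simp

/-- The quotient is unchanged under `t ↦ 2t`, and along `2^n t → ∞` the modulus tends to `0` and
`θ₃` to `1`, so it equals `1`. -/
theorem ellipticSeries_modulusR {t : ℝ} (ht : 0 < t) :
    ellipticSeries (modulusR t ^ 2) = theta3R t ^ 2 := by
  have hit (n : ℕ) : ellipticSeries (modulusR (2 ^ n * t) ^ 2) / theta3R (2 ^ n * t) ^ 2 =
      ellipticSeries (modulusR t ^ 2) / theta3R t ^ 2 := by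
    induction n with
    | zero => simp
    | succ n ih =>
      rw [← ih, ellipticSeries_modulusR_div (t := 2 ^ n * t) (by positivity), ← mul_assoc,
        ← pow_succ']
  have hlim : Tendsto (fun n : ℕ => 2 ^ n * t) atTop atTop :=
    (tendsto_pow_atTop_atTop_of_one_lt one_lt_two).atTop_mul_const ht
  have l3 := (tendsto_theta3R.comp hlim).pow 2
  have l2 := (tendsto_theta2R.comp hlim).pow 2
  have lk : Tendsto (fun n : ℕ => modulusR (2 ^ n * t) ^ 2) atTop (𝓝 0) := by
    have := (l2.div l3 (by norm_num)).pow 2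
    simpa using! this
  have lE := tendsto_ellipticSeries (fun n => sq_nonneg _) lk
  have l := lE.div l3 (by norm_num)
  have hc : Tendsto (fun _ : ℕ => ellipticSeries (modulusR t ^ 2) / theta3R t ^ 2) atTop
      (𝓝 (1 / 1 ^ 2)) := l.congr fun n => hit n
  have := tendsto_nhds_unique tendsto_const_nhds hc
  have h3 := theta3R_pos ht
  field_simp at this
  linarith

theorem ellipticSeries_modulusR_ratio {t : ℝ} (ht : 0 < t) :
    ellipticSeries (1 - modulusR t ^ 2) / ellipticSeries (modulusR t ^ 2) = t := by
  have h3 := theta3R_pos ht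
  rw [one_sub_modulusR_sq ht, ellipticSeries_modulusR ht, ellipticSeries_modulusR (by positivity)]
  rw [theta3R_modular ht]
  have h3' := theta3R_pos (t := 1 / t) (by positivity)
  rw [div_pow, Real.sq_sqrt ht.le]
  field_simp

/-- The ratio `K(√(1 - k ^ 2)) / K(k)` is strictly decreasing in `k`. -/
theorem ellipticSeries_ratio_lt {x y : ℝ} (hx : 0 < x) (hxy : x < y) (hy : y < 1) :
    ellipticSeries (1 - y ^ 2) / ellipticSeries (y ^ 2) <
      ellipticSeries (1 - x ^ 2) / ellipticSeries (x ^ 2) := by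
  have h1 : x ^ 2 < y ^ 2 := by gcongr
  have h2 : y ^ 2 < 1 := pow_lt_one₀ (hx.trans hxy).le hy two_ne_zero
  have h3 : 0 < x ^ 2 := by positivity
  have a := ellipticSeries_lt h3.le h1 h2
  have b := ellipticSeries_lt (a := 1 - y ^ 2) (b := 1 - x ^ 2) (by linarith) (by linarith)
    (by linarith)
  have c := one_le_ellipticSeries h3.le (h1.trans h2)
  have d := one_le_ellipticSeries (m := 1 - y ^ 2) (by linarith) (by linarith)
  gcongr
  all_goals linarith

theorem IsSingularModulus.eq_modulus {r x : ℝ} (hr : 0 < r) (h : IsSingularModulus r x) :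
    (x : ℂ) = modulus ((Real.sqrt r / 2 : ℝ) * I) := by
  obtain ⟨h0, h1, h2⟩ := h
  have ht := Real.sqrt_pos.mpr hr
  rw [modulus_ofReal_mul_I]
  congr 1
  have hx2 : 0 ≤ 1 - x ^ 2 := by nlinarith
  rw [ellipticK_ofReal, ellipticK_ofReal, Real.sq_sqrt hx2] at h2
  have h3 : Real.pi / 2 * ellipticSeries (1 - x ^ 2) / (Real.pi / 2 * ellipticSeries (x ^ 2)) =
      Real.sqrt r := by exact_mod_cast h2
  rw [mul_div_mul_left _ _ (by positivity), ← ellipticSeries_modulusR_ratio ht] at h3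
  have hm0 := modulusR_pos ht
  have hm1 := modulusR_lt_one ht
  -- Both moduli have ratio `√r`, so strict monotonicity excludes either inequality.
  rcases lt_trichotomy x (modulusR (Real.sqrt r)) with h | h | h
  · exact absurd h3 (ellipticSeries_ratio_lt h0 h hm1).ne'
  · exact h
  · exact absurd h3 (ellipticSeries_ratio_lt hm0 h h1).ne

end

/-- Here `q = e(z)` is either `exp (-π √r)` with `k = k_r` the singular modulus and `K = K(k_r)`,
or an arbitrary nome with `k = m(q)` and `K = K(m(q))`. -/
theorem theorem14 (z k K : ℂ) (hz : 0 < z.im)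
    (hkK : (∃ r x : ℝ, 0 < r ∧ IsSingularModulus r x ∧
              z = (Real.sqrt r / 2 : ℝ) * Complex.I ∧ k = x ∧ K = ellipticK x) ∨
           (k = modulus z ∧ ∃ κ : ℂ → ℂ, IsKContinuation κ ∧ K = κ z)) :
    (∃ L : ℂ → ℂ, IsLogUZero (nome z) L) ∧
    (∃ M : ℂ → ℂ, IsLogNdSd z k K M) ∧
    ∀ L M : ℂ → ℂ, IsLogUZero (nome z) L → IsLogNdSd z k K M →
      ∀ u ∈ uStrip z K, ∀ A : ℂ,
        A = Complex.I * qpow z (1 / 2) * Complex.exp (Complex.I * Real.pi * u / (2 * K)) →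
        ‖A‖ < 1 ∧
        Summable (fun n : ℕ => (-1) ^ n * qpow z (n + 1 / 2) *
          Complex.cos ((2 * n + 1) * (Real.pi / (2 * K)) * u) /
            ((2 * n + 1) * (1 - nome z ^ (2 * n + 1)))) ∧
        L A = -M u + 4 * Complex.I * ∑' n : ℕ, (-1) ^ n * qpow z (n + 1 / 2) *
          Complex.cos ((2 * n + 1) * (Real.pi / (2 * K)) * u) /
            ((2 * n + 1) * (1 - nome z ^ (2 * n + 1))) := by
  have hk : k = modulus z := by
    rcases hkK with ⟨r, x, hr, hx, rfl, rfl, -⟩ | ⟨hk, -⟩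
    · exact hx.eq_modulus hr
    · exact hk
  subst hk
  exact log_uZero_eq hz K
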